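/- Write $\omega=\{0,1,2,\dots\}$ and $[\omega]^2$ for the set of unordered pairs of elements of $\omega$. For infinite $D\subseteq\omega$ put $FS(D)=\{\sum_{n\in\alpha}n:\emptyset\ne\alpha\subseteq D \text{ finite}\}$, $r(D)=[D]^2$, $\Delta(D)=\{a-b:a,b\in D,\ a>b\}$. For $\rho\in\{FS,r,\Delta\}$ let $\Lambda_\rho$ be $\omega$, $[\omega]^2$, $\omega$ respectively, and let $\mathcal I_\rho$ be the family of all $A\subseteq\Lambda_\rho$ such that $\rho(D)\not\subseteq A$ for every infinite $D\subseteq\omega$; put $\mathcal H=\mathcal I_{FS}$, $\mathcal R=\mathcal I_r$, $\mathcal D=\mathcal I_\Delta$. A topological space $X$ is a Hindman (Ramsey, differentially compact, resp.) space if, for $\rho=FS$ ($\rho=r$, $\rho=\Delta$, resp.), for every $f:\Lambda_\rho\to X$ there are an infinite $D\subseteq\omega$ and $x\in X$ such that every neighbourhood $U$ of $x$ satisfies $f[\rho(D\setminus K)]\subseteq U$ for some finite $K\subseteq\omega$. An ideal on a countably infinite set $\Lambda$ is a family of subsets of $\Lambda$ that is closed under subsets and finite unions, contains all finite subsets of $\Lambda$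 and does not contain $\Lambda$. A space $X$ is in $\mathrm{FinBW}(\mathcal I)$ (is an $\mathcal I$-space) if for every $f:\Lambda\to X$ there is $A\subseteq\Lambda$, $A\notin\mathcal I$, such that $f\restriction A$ converges. We write $\mathcal I_2\le_K\mathcal I_1$, for $\mathcal I_i$ a family of subsets of $\Lambda_i$, if there is $\varphi:\Lambda_1\to\Lambda_2$ with $\varphi[A]\notin\mathcal I_2$ for every $A\subseteq\Lambda_1$ with $A\notin\mathcal I_1$. Let $\mathcal I_{1/n}=\{A\subseteq\omega:\sum_{n\in A}\frac1{n+1}<\infty\}$. An almost disjoint family on $\omega$ is a family $\mathcal A$ of infinite subsets of $\omega$ such that any two distinct members have finite intersection. For infinite such $\mathcal A$, $\Psi(\mathcal A)=\omega\cup\mathcal A$ (disjoint union) carries the topology in which the points of $\omega$ are isolated and the basic neighbourhoods of $A\in\mathcal A$ are the sets $\{A\}\cup(A\setminus F)$ with $F$ finite, and $\Phi(\mathcal A)$ is the one-point compactification of $\Psi(\mathcal A)$. **Corollary.** Assume the continuum hypothesis. (1) Let $\mathcal I$ be an ideal on a countably infinite set. If $\mathcal I\not\le_K\mathcal H$ ($\mathcal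 I\not\le_K\mathcal R$, $\mathcal I\not\le_K\mathcal D$, resp.), then there is an infinite almost disjoint family $\mathcal A$ on $\omega$ such that $\Phi(\mathcal A)$ is a Hausdorff, compact, separable space of cardinality $\mathfrak c$ that is a Hindman (Ramsey, differentially compact, resp.) space and is not in $\mathrm{FinBW}(\mathcal I)$. (2) There is an infinite almost disjoint family $\mathcal A$ on $\omega$ such that $\Phi(\mathcal A)$ is a Hausdorff, compact, separable space of cardinality $\mathfrak c$ that is a Hindman (Ramsey, differentially compact, resp.) space and is not an $\mathcal I_{1/n}$-space. -/

import Mathlib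

open Set Filter Topology Cardinal

/-- `I` is an ideal on the set `Λ`: closed under subsets and finite unions, proper, and
containing all finite sets. -/
structure IsIdealOn {Λ : Type*} (I : Set (Set Λ)) : Prop where
  subset_mem : ∀ A B : Set Λ, A ⊆ B → B ∈ I → A ∈ I
  union_mem : ∀ A B : Set Λ, A ∈ I → B ∈ I → A ∪ B ∈ I
  univ_notMem : (Set.univ : Set Λ) ∉ I
  finite_mem : ∀ A : Set Λ, A.Finite → A ∈ I

/-- The Katetov order: `KatetovLE J I` says that `J` is below `I`, that is, some map of the
underlying sets sends every set outside `I` to a set outside `J`. -/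
def KatetovLE {Λ₂ Λ₁ : Type*} (J : Set (Set Λ₂)) (I : Set (Set Λ₁)) : Prop :=
  ∃ φ : Λ₁ → Λ₂, ∀ A : Set Λ₁, A ∉ I → φ '' A ∉ J

/-- `FS(D)`: all sums of finite nonempty sets of (distinct) elements of `D`. -/
def finiteSums (D : Set ℕ) : Set ℕ :=
  {n | ∃ α : Finset ℕ, α.Nonempty ∧ (α : Set ℕ) ⊆ D ∧ ∑ i ∈ α, i = n}

/-- The set `[ω]²` of all unordered pairs of natural numbers. -/
abbrev NatPair : Type := Set.powersetCard ℕ 2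

/-- `r(H) = [H]²`: all unordered pairs of elements of `H`. -/
def pairsOf (H : Set ℕ) : Set NatPair :=
  {s | (s.1 : Set ℕ) ⊆ H}

/-- `Δ(E)`: all positive differences of elements of `E`. -/
def posDifferences (E : Set ℕ) : Set ℕ :=
  {d | ∃ a ∈ E, ∃ b ∈ E, b < a ∧ a - b = d}

/-- For `ρ : [ω]^ω → [Λ]^ω` (only its values at infinite sets are used), the family of all
sets that contain no `ρ(D)` with `D` infinite. -/
def idealOf {Λ : Type*} (ρ : Set ℕ → Set Λ) : Set (Set Λ) :=
  {A | ∀ D : Set ℕ, D.Infinite → ¬ ρ D ⊆ A}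

/-- The Hindman ideal. -/
def hindmanIdeal : Set (Set ℕ) := idealOf finiteSums

/-- The Ramsey ideal. -/
def ramseyIdeal : Set (Set NatPair) := idealOf pairsOf

/-- The ideal `𝒟` of sets that contain no `Δ(E)` with `E` infinite. -/
def differenceIdeal : Set (Set ℕ) := idealOf posDifferences

/-- The summable ideal. -/
def summableIdeal : Set (Set ℕ) :=
  {A | Summable (fun n : A => 1 / (((n : ℕ) : ℝ) + 1))}

/-- `f ↾ ρ(D)` is `ρ`-convergent to `x`. -/
def RhoConverges {Λ X : Type*} [TopologicalSpace X] (ρ : Set ℕ → Set Λ) (f : Λ → X)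
    (D : Set ℕ) (x : X) : Prop :=
  ∀ U ∈ 𝓝 x, ∃ K : Set ℕ, K.Finite ∧ f '' ρ (D \ K) ⊆ U

/-- The class `FinBW(ρ)` for `ρ : [ω]^ω → [Λ]^ω`. -/
def FinBWRho {Λ : Type*} (ρ : Set ℕ → Set Λ) (X : Type*) [TopologicalSpace X] : Prop :=
  ∀ f : Λ → X, ∃ D : Set ℕ, D.Infinite ∧ ∃ x : X, RhoConverges ρ f D x

/-- Hindman spaces (`ρ`-convergence is here IP-convergence). -/
def IsHindmanSpace (X : Type*) [TopologicalSpace X] : Prop := FinBWRho finiteSums X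

/-- Ramsey spaces. -/
def IsRamseySpace (X : Type*) [TopologicalSpace X] : Prop := FinBWRho pairsOf X

/-- Differentially compact spaces. -/
def IsDifferentiallyCompact (X : Type*) [TopologicalSpace X] : Prop :=
  FinBWRho posDifferences X

/-- The class `FinBW(I)` for an ideal `I`: every sequence indexed by `Λ` has a convergent
subsequence indexed by a set outside `I`. -/
def FinBW {Λ : Type*} (I : Set (Set Λ)) (X : Type*) [TopologicalSpace X] : Prop :=
  ∀ f : Λ → X, ∃ A : Set Λ, A ∉ I ∧ ∃ x : X, Tendsto (fun a : A => f a) cofinite (𝓝 x)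

/-- Almost disjoint families on `ω`. -/
def IsAlmostDisjoint (𝒜 : Set (Set ℕ)) : Prop :=
  (∀ A ∈ 𝒜, A.Infinite) ∧ ∀ A ∈ 𝒜, ∀ B ∈ 𝒜, A ≠ B → (A ∩ B).Finite

/-- The underlying set `ω ∪ 𝒜` (a disjoint union) of the Mrowka space. -/
inductive MrowkaSpace (𝒜 : Set (Set ℕ)) : Type
  | nat (n : ℕ) : MrowkaSpace 𝒜
  | mem (A : 𝒜) : MrowkaSpace 𝒜

/-- The Mrowka topology: points of `ω` are isolated, and the basic neighbourhoods of `A ∈ 𝒜`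
are the sets `{A} ∪ (A \ F)` with `F` finite. -/
instance (𝒜 : Set (Set ℕ)) : TopologicalSpace (MrowkaSpace 𝒜) where
  IsOpen U := ∀ A : 𝒜, MrowkaSpace.mem A ∈ U →
    ∃ F : Set ℕ, F.Finite ∧ ∀ n ∈ (A : Set ℕ) \ F, MrowkaSpace.nat n ∈ U
  isOpen_univ := fun _ _ => ⟨∅, Set.finite_empty, fun _ _ => Set.mem_univ _⟩
  isOpen_inter := fun U V hU hV A hA => by
    obtain ⟨F, hF, hFU⟩ := hU A hA.1
    obtain ⟨G, hG, hGV⟩ := hV A hA.2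
    exact ⟨F ∪ G, hF.union hG, fun n hn =>
      ⟨hFU n ⟨hn.1, fun h => hn.2 (Or.inl h)⟩, hGV n ⟨hn.1, fun h => hn.2 (Or.inr h)⟩⟩⟩
  isOpen_sUnion := fun S hS A hA => by
    obtain ⟨U, hU, hAU⟩ := hA
    obtain ⟨F, hF, hFU⟩ := hS U hU A hAU
    exact ⟨F, hF, fun n hn => ⟨U, hU, hFU n hn⟩⟩

/-- `Φ(𝒜)`: the one-point compactification of the Mrowka space of `𝒜`. -/
abbrev FranklinSpace (𝒜 : Set (Set ℕ)) : Type := OnePoint (MrowkaSpace 𝒜)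

/-- `𝒜` is an infinite almost disjoint family on `ω` for which `Φ(𝒜)` is a Hausdorff, compact,
separable space of cardinality continuum. -/
def HasNiceFranklinSpace (𝒜 : Set (Set ℕ)) : Prop :=
  𝒜.Infinite ∧ IsAlmostDisjoint 𝒜 ∧ T2Space (FranklinSpace 𝒜) ∧
    CompactSpace (FranklinSpace 𝒜) ∧ TopologicalSpace.SeparableSpace (FranklinSpace 𝒜) ∧
    #(FranklinSpace 𝒜) = 𝔠

/-! Under CH all maps `f : Λ → ℕ` and all `A ∉ I` can be treated in `ℵ₁` steps, each facing only
countably many earlier choices. What is built is a family `C` of pairwise eventually disjoint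
sequences of sets, each with first term in `I`. The sequences `tails B` with `B` infinite give the
almost disjoint family; the remaining sequences stand for ways of converging to the point at
infinity.

Given `f`, the failure of `I ≤_K idealOf ρ` yields `D₀` with `f '' ρ D₀ ∈ I`. A diagonalizing
ultrafilter `p` on `ρ D₀` then decides: `f` is constant on a set of `p`, or follows a sequence
already in `C`, or can be kept away from all of `C` and yields a new sequence
(`exists_extension_convergesAlong`). Given `A ∉ I`, tallness of `I` gives an infinite `B ⊆ A` in `I`
orthogonal to `C` (`exists_extension_tails`). The first kind of step gives `FinBWRho`. The second
refutes `FinBW I`: if the identity converged on `A ∉ I`, its limit would be a point `B ⊆ A` of the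
family with `A \ B` finite, although `B ∈ I`.

The ultrafilters are Fubini squares for pairs, their images for differences, and idempotents for
finite sums. For the summable ideal, thinning out `D` makes the distinct values of `φ` on `ρ D` grow
geometrically. -/

/-! ### Diagonalizing ultrafilters for pairs, differences and finite sums. -/

/-- Every infinite `E` carries an ultrafilter containing all the sets `ρ (E \ K)` such that each
countable subfamily of it is diagonalized by some `ρ (D)`. -/
def HasDiagonalUltrafilters {Λ : Type*} (ρ : Set ℕ → Set Λ) : Prop :=
  ∀ E : Set ℕ, E.Infinite → ∃ p : Ultrafilter Λ, (p : Filter Λ) ≤ cofinite ∧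
    (∀ K : Set ℕ, K.Finite → ρ (E \ K) ∈ p) ∧
    ∀ A : ℕ → Set Λ, (∀ n, A n ∈ p) →
      ∃ D : Set ℕ, D.Infinite ∧ ∀ n, ∃ K : Set ℕ, K.Finite ∧ ρ (D \ K) ⊆ A n

/-- The recursion common to all diagonalizations below. The history is a total function `h`, so that
`R` needs no dependent types; only its values below `n` carry information. -/
theorem exists_strictMono_of_eventually (U : Filter ℕ) [U.NeBot] (hU : U ≤ cofinite)
    (R : ℕ → (ℕ → ℕ) → ℕ → Prop) (hR : ∀ n h, ∀ᶠ x in U, R n h x) :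
    ∃ d : ℕ → ℕ, StrictMono d ∧ ∀ n, ∃ h : ℕ → ℕ, (∀ i < n, h i = d i) ∧ R n h (d n) := by
  have hex : ∀ n h, ∃ x, R n h x ∧ ∀ i < n, h i < x := by
    intro n h
    have h1 : ∀ᶠ x in U, ∀ i ∈ Finset.range n, h i < x := by
      rw [Filter.eventually_all_finset]
      intro i _
      apply hU
      rw [Nat.cofinite_eq_atTop]
      exact eventually_gt_atTop (h i)
    obtain ⟨x, hx, hx'⟩ := ((hR n h).and h1).exists
    exact ⟨x, hx, fun i hi => hx' i (Finset.mem_range.2 hi)⟩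
  choose g hg hg' using hex
  let d : ℕ → ℕ := WellFounded.fix Nat.lt_wfRel.wf
    (fun n ih => g n (fun i => if hi : i < n then ih i hi else 0))
  have hd : ∀ n, d n = g n (fun i => if i < n then d i else 0) := by
    intro n
    have := WellFounded.fix_eq Nat.lt_wfRel.wf
      (fun n (ih : ∀ i, i < n → ℕ) => g n (fun i => if hi : i < n then ih i hi else 0)) n
    simp only [dite_eq_ite] at this
    exact this
  refine ⟨d, ?_, fun n => ⟨fun i => if i < n then d i else 0, fun i hi => if_pos hi, ?_⟩⟩
  · intro m n hmn
    have := hg' n (fun i => if i < n then d i else 0) m hmn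
    rw [hd n]
    simpa [hmn] using this
  · rw [hd n]
    exact hg _ _

theorem exists_ultrafilter_mem_le_cofinite {E : Set ℕ} (hE : E.Infinite) :
    ∃ v : Ultrafilter ℕ, (v : Filter ℕ) ≤ cofinite ∧ E ∈ v := by
  have := hE.cofinite_inf_principal_neBot
  refine ⟨Ultrafilter.of (cofinite ⊓ 𝓟 E), (Ultrafilter.of_le _).trans inf_le_left, ?_⟩
  exact (Ultrafilter.of_le _).trans inf_le_right (mem_principal_self E)

/-- The pair `{a, b}` (a junk value if `a = b`). -/
noncomputable def mkNatPair (a b : ℕ) : NatPair :=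
  if h : a ≠ b then ⟨{a, b}, Finset.card_pair h⟩ else ⟨{0, 1}, Finset.card_pair zero_ne_one⟩

theorem coe_mkNatPair {a b : ℕ} (h : a ≠ b) : ((mkNatPair a b).1 : Finset ℕ) = {a, b} := by
  rw [mkNatPair, dif_pos h]

theorem exists_eq_mkNatPair (s : NatPair) : ∃ a b, a < b ∧ s = mkNatPair a b := by
  obtain ⟨a, b, hab, hs⟩ := Finset.card_eq_two.1 s.2
  rcases lt_or_gt_of_ne hab with h | h
  · exact ⟨a, b, h, Subtype.ext (by rw [coe_mkNatPair h.ne, hs])⟩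
  · exact ⟨b, a, h, Subtype.ext (by rw [coe_mkNatPair h.ne, hs, Finset.pair_comm])⟩

theorem mkNatPair_mem_pairsOf {a b : ℕ} (h : a ≠ b) {D : Set ℕ} :
    mkNatPair a b ∈ pairsOf D ↔ a ∈ D ∧ b ∈ D := by
  change (((mkNatPair a b).1 : Finset ℕ) : Set ℕ) ⊆ D ↔ _
  rw [coe_mkNatPair h]
  simp [Set.insert_subset_iff]

theorem pairsOf_range_sdiff_subset {d : ℕ → ℕ} (hd : StrictMono d) {n : ℕ} {A : Set NatPair}
    (h : ∀ i j, n ≤ i → i < j → mkNatPair (d i) (d j) ∈ A) :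
    pairsOf (range d \ d '' Iio n) ⊆ A := by
  intro s hs
  obtain ⟨a, b, hab, rfl⟩ := exists_eq_mkNatPair s
  obtain ⟨⟨⟨i, rfl⟩, hi⟩, ⟨⟨j, rfl⟩, -⟩⟩ := (mkNatPair_mem_pairsOf hab.ne).1 hs
  refine h i j ?_ (hd.lt_iff_lt.1 hab)
  by_contra hin
  exact hi ⟨i, not_le.1 hin, rfl⟩

/-- The Fubini square of an ultrafilter on `ℕ`, as an ultrafilter on pairs. -/
noncomputable def pairUltrafilter (v : Ultrafilter ℕ) : Ultrafilter NatPair :=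
  v.bind fun a => v.map (mkNatPair a)

theorem mem_pairUltrafilter {v : Ultrafilter ℕ} {X : Set NatPair} :
    X ∈ pairUltrafilter v ↔ ∀ᶠ a in v, ∀ᶠ b in v, mkNatPair a b ∈ X := Iff.rfl

theorem eventually_lt_of_le_cofinite {v : Filter ℕ} (hv : v ≤ cofinite) (n : ℕ) :
    ∀ᶠ x in v, n < x := by
  apply hv
  rw [Nat.cofinite_eq_atTop]
  exact eventually_gt_atTop n

theorem Set.Finite.eventually_notMem_of_le {α : Type*} {K : Set α} (hK : K.Finite) {v : Filter α}
    (hv : v ≤ cofinite) : ∀ᶠ x in v, x ∉ K :=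
  hv hK.eventually_cofinite_notMem

/-- Each `d i` is chosen so that `{d i, e}` lies in `A k` for almost all `e`, for every `k ≤ i`; a
later `d j` has to meet only finitely many of these large sets. The first condition is an
implication because it must hold almost everywhere for an arbitrary history. -/
theorem pairUltrafilter_diagonal {v : Ultrafilter ℕ} (hv : (v : Filter ℕ) ≤ cofinite)
    (A : ℕ → Set NatPair) (hA : ∀ n, A n ∈ pairUltrafilter v) :
    ∃ D : Set ℕ, D.Infinite ∧ ∀ n, ∃ K : Set ℕ, K.Finite ∧ pairsOf (D \ K) ⊆ A n := by
  obtain ⟨d, hd, hR⟩ := exists_strictMono_of_eventually v hv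
    (fun n h x => (∀ i < n, ∀ k ≤ n, (∀ᶠ e in v, mkNatPair (h i) e ∈ A k) →
      mkNatPair (h i) x ∈ A k) ∧ ∀ k ≤ n, ∀ᶠ e in v, mkNatPair x e ∈ A k) (by
    intro n h
    refine Filter.Eventually.and ?_ ?_
    · refine (Filter.eventually_all_finite (Set.finite_Iio n)).2 fun i _ => ?_
      refine (Filter.eventually_all_finite (Set.finite_Iic n)).2 fun k _ => ?_
      by_cases hk : ∀ᶠ e in v, mkNatPair (h i) e ∈ A k
      · filter_upwards [hk] with x hx _ using hx
      · exact Filter.Eventually.of_forall fun x hx => absurd hx hk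
    · exact (Filter.eventually_all_finite (Set.finite_Iic n)).2 fun k _ =>
        mem_pairUltrafilter.1 (hA k))
  refine ⟨range d, infinite_range_of_injective hd.injective, fun n =>
    ⟨d '' Iio n, (finite_Iio n).image d, pairsOf_range_sdiff_subset hd fun i j hi hij => ?_⟩⟩
  obtain ⟨h, hh, hj, -⟩ := hR j
  obtain ⟨h', -, -, hi'⟩ := hR i
  rw [← hh i hij]
  exact hj i hij n (hi.trans hij.le) (by rw [hh i hij]; exact hi' n hi)

theorem pairsOf_mem_pairUltrafilter {v : Ultrafilter ℕ} (hv : (v : Filter ℕ) ≤ cofinite)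
    {E : Set ℕ} (hE : E ∈ v) : pairsOf E ∈ pairUltrafilter v := by
  rw [mem_pairUltrafilter]
  filter_upwards [hE] with a ha
  filter_upwards [hE, eventually_lt_of_le_cofinite hv a] with b hb hab
  exact (mkNatPair_mem_pairsOf hab.ne).2 ⟨ha, hb⟩

theorem pairUltrafilter_le_cofinite {v : Ultrafilter ℕ} (hv : (v : Filter ℕ) ≤ cofinite) :
    (pairUltrafilter v : Filter NatPair) ≤ cofinite := by
  rw [le_cofinite_iff_compl_singleton_mem]
  intro s
  have : {n | n ∉ (s.1 : Set ℕ)} ∈ v :=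
    (Finset.finite_toSet s.1).eventually_notMem_of_le hv
  filter_upwards [pairsOf_mem_pairUltrafilter hv this] with t ht hts
  obtain ⟨a, b, hab, rfl⟩ := exists_eq_mkNatPair t
  have h1 := ((mkNatPair_mem_pairsOf hab.ne).1 ht).1
  have hts' : mkNatPair a b = s := hts
  apply h1
  rw [← hts', coe_mkNatPair hab.ne]
  simp

theorem sdiff_mem_of_le_cofinite {α : Type*} {v : Ultrafilter α} (hv : (v : Filter α) ≤ cofinite)
    {E K : Set α} (hE : E ∈ v) (hK : K.Finite) : E \ K ∈ v := by
  filter_upwards [hE, hK.eventually_notMem_of_le hv] with x hx hx' using ⟨hx, hx'⟩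

theorem hasDiagonalUltrafilters_pairsOf : HasDiagonalUltrafilters pairsOf := by
  intro E hE
  obtain ⟨v, hv, hEv⟩ := exists_ultrafilter_mem_le_cofinite hE
  exact ⟨pairUltrafilter v, pairUltrafilter_le_cofinite hv,
    fun K hK => pairsOf_mem_pairUltrafilter hv (sdiff_mem_of_le_cofinite hv hEv hK),
    pairUltrafilter_diagonal hv⟩

/-- The difference of the two elements of a pair. -/
def pairDifference (s : NatPair) : ℕ := s.1.sup id - (∑ i ∈ s.1, i - s.1.sup id)

theorem pairDifference_mkNatPair {a b : ℕ} (h : a < b) :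
    pairDifference (mkNatPair a b) = b - a := by
  have : (∑ i ∈ ({a, b} : Finset ℕ), i) = a + b := Finset.sum_pair h.ne
  simp only [pairDifference, coe_mkNatPair h.ne, this]
  simp [h.le]

/-- Reduces every statement about differences to one about pairs. -/
theorem posDifferences_eq_image (E : Set ℕ) : posDifferences E = pairDifference '' pairsOf E := by
  ext x
  constructor
  · rintro ⟨a, ha, b, hb, hba, rfl⟩
    exact ⟨mkNatPair b a, (mkNatPair_mem_pairsOf hba.ne).2 ⟨hb, ha⟩, pairDifference_mkNatPair hba⟩
  · rintro ⟨s, hs, rfl⟩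
    obtain ⟨a, b, hab, rfl⟩ := exists_eq_mkNatPair s
    obtain ⟨ha, hb⟩ := (mkNatPair_mem_pairsOf hab.ne).1 hs
    exact ⟨b, hb, a, ha, hab, (pairDifference_mkNatPair hab).symm⟩

theorem hasDiagonalUltrafilters_posDifferences : HasDiagonalUltrafilters posDifferences := by
  intro E hE
  obtain ⟨v, hv, hEv⟩ := exists_ultrafilter_mem_le_cofinite hE
  refine ⟨(pairUltrafilter v).map pairDifference, ?_, fun K hK => ?_, fun A hA => ?_⟩
  · rw [le_cofinite_iff_compl_singleton_mem]
    intro x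
    change ∀ᶠ a in (v : Filter ℕ), ∀ᶠ b in (v : Filter ℕ),
      pairDifference (mkNatPair a b) ∈ ({x} : Set ℕ)ᶜ
    refine Filter.Eventually.of_forall fun a => ?_
    filter_upwards [eventually_lt_of_le_cofinite hv (a + x)] with b hb
    change ¬ pairDifference (mkNatPair a b) = x
    rw [pairDifference_mkNatPair (by omega)]
    omega
  · rw [posDifferences_eq_image]
    exact image_mem_map
      (pairsOf_mem_pairUltrafilter hv (sdiff_mem_of_le_cofinite hv hEv hK))
  · obtain ⟨D, hD, h⟩ := pairUltrafilter_diagonal hv (fun n => pairDifference ⁻¹' A n) hA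
    refine ⟨D, hD, fun n => ?_⟩
    obtain ⟨K, hK, hKA⟩ := h n
    refine ⟨K, hK, ?_⟩
    rw [posDifferences_eq_image]
    exact image_subset_iff.2 hKA

/-- The ultrafilters containing all `finiteSums (E \ K)` form a nonempty closed subsemigroup of
`βℕ`, which contains an idempotent by Ellis' theorem. -/
theorem exists_additive_ultrafilter {E : Set ℕ} (hE : E.Infinite) :
    ∃ U : Ultrafilter ℕ, (∀ P : ℕ → Prop, (∀ᶠ m in U, P m) ↔ ∀ᶠ m in U, ∀ᶠ n in U, P (m + n)) ∧
      ∀ K : Set ℕ, K.Finite → finiteSums (E \ K) ∈ U := by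
  let _ := Ultrafilter.addSemigroup (M := ℕ)
  let S : Set (Ultrafilter ℕ) := {U | ∀ K : Set ℕ, K.Finite → finiteSums (E \ K) ∈ U}
  have hS : S = ⋂ K : {K : Set ℕ // K.Finite}, {U : Ultrafilter ℕ | finiteSums (E \ K) ∈ U} := by
    ext U
    simp [S]
  have hclosed : IsClosed S := by
    rw [hS]
    exact isClosed_iInter fun K => ultrafilter_isClosed_basic _
  have hne : S.Nonempty := by
    obtain ⟨v, hv, hEv⟩ := exists_ultrafilter_mem_le_cofinite hE
    refine ⟨v, fun K hK => ?_⟩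
    filter_upwards [sdiff_mem_of_le_cofinite hv hEv hK] with x hx
    exact ⟨{x}, Finset.singleton_nonempty x, by simpa using hx, by simp⟩
  obtain ⟨U, hU, hUU⟩ := exists_idempotent_in_compact_add_subsemigroup
    (M := Ultrafilter ℕ) Ultrafilter.continuous_add_left S hne hclosed.isCompact (by
      intro U hU V hV K hK
      change ∀ᶠ m in U, ∀ᶠ n in V, m + n ∈ finiteSums (E \ K)
      filter_upwards [hU K hK] with m hm
      obtain ⟨α, hα, hαE, rfl⟩ := hm
      -- The second sum avoids the summands of the first, so the two index sets are disjoint.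
      filter_upwards [hV (K ∪ α) (hK.union α.finite_toSet)] with n hn
      obtain ⟨β, hβ, hβE, rfl⟩ := hn
      have hdisj : Disjoint α β := by
        rw [Finset.disjoint_left]
        intro x hxα hxβ
        exact (hβE hxβ).2 (Or.inr hxα)
      refine ⟨α ∪ β, hα.mono Finset.subset_union_left, ?_, Finset.sum_union hdisj⟩
      rw [Finset.coe_union]
      exact union_subset hαE fun x hx => ⟨(hβE hx).1, fun h => (hβE hx).2 (Or.inl h)⟩)
  refine ⟨U, fun P => ?_, hU⟩
  conv_lhs => rw [← hUU]
  exact Iff.rfl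

theorem le_cofinite_of_finiteSums_mem {E : Set ℕ} {U : Ultrafilter ℕ}
    (hU : ∀ K : Set ℕ, K.Finite → finiteSums (E \ K) ∈ U) : (U : Filter ℕ) ≤ cofinite := by
  rw [le_cofinite_iff_compl_singleton_mem]
  intro x
  filter_upwards [hU (Iic x) (finite_Iic x)] with y hy hyx
  obtain ⟨α, ⟨a, ha⟩, hαE, rfl⟩ := hy
  have h1 : a ≤ ∑ i ∈ α, i := Finset.single_le_sum (f := fun i => i) (fun _ _ => Nat.zero_le _) ha
  have h2 : ∑ i ∈ α, i = x := hyx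
  exact (hαE ha).2 (h1.trans_eq h2)

theorem exists_indices_of_mem_finiteSums {d : ℕ → ℕ} (hd : StrictMono d) {n x : ℕ}
    (hx : x ∈ finiteSums (range d \ d '' Iio n)) :
    ∃ β : Finset ℕ, β.Nonempty ∧ (∀ i ∈ β, n ≤ i) ∧ ∑ i ∈ β, d i = x := by
  obtain ⟨α, ⟨a, ha⟩, hα, rfl⟩ := hx
  refine ⟨α.preimage d hd.injective.injOn, ?_, fun i hi => ?_, ?_⟩
  · obtain ⟨i, rfl⟩ := (hα ha).1
    exact ⟨i, Finset.mem_preimage.2 ha⟩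
  · by_contra h
    exact (hα (Finset.mem_preimage.1 hi)).2 ⟨i, not_le.1 h, rfl⟩
  · exact Finset.sum_preimage d α hd.injective.injOn (fun i => i)
      fun x hx hx' => absurd (hα hx).1 hx'

/-- The Galvin–Glazer argument: if `s + e ∈ A k` for almost all `e`, idempotence gives, for almost
every `x`, both `s + x ∈ A k` and the same invariant at `s + x`. -/
theorem additive_ultrafilter_diagonal {U : Ultrafilter ℕ}
    (hadd : ∀ P : ℕ → Prop, (∀ᶠ m in U, P m) ↔ ∀ᶠ m in U, ∀ᶠ n in U, P (m + n))
    (hcof : (U : Filter ℕ) ≤ cofinite) (A : ℕ → Set ℕ) (hA : ∀ n, A n ∈ U) :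
    ∃ D : Set ℕ, D.Infinite ∧ ∀ n, ∃ K : Set ℕ, K.Finite ∧ finiteSums (D \ K) ⊆ A n := by
  obtain ⟨d, hd, hR⟩ := exists_strictMono_of_eventually U hcof
    (fun n h x => ∀ β ∈ (Finset.range n).powerset, ∀ k ≤ n,
      (∀ᶠ e in U, ∑ i ∈ β, h i + e ∈ A k) →
      (∑ i ∈ β, h i + x ∈ A k ∧ ∀ᶠ e in U, ∑ i ∈ β, h i + x + e ∈ A k)) (by
    intro n h
    refine (Filter.eventually_all_finset _).2 fun β _ => ?_
    refine (Filter.eventually_all_finite (Set.finite_Iic n)).2 fun k _ => ?_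
    by_cases hk : ∀ᶠ e in U, ∑ i ∈ β, h i + e ∈ A k
    · have h2 := (hadd _).1 hk
      filter_upwards [hk, h2] with x hx hx' _
      exact ⟨hx, by simpa only [add_assoc] using hx'⟩
    · exact Filter.Eventually.of_forall fun x hx => absurd hx hk)
  refine ⟨range d, infinite_range_of_injective hd.injective, fun n =>
    ⟨d '' Iio n, (finite_Iio n).image d, fun x hx => ?_⟩⟩
  obtain ⟨β, hβ, hβn, rfl⟩ := exists_indices_of_mem_finiteSums hd hx
  -- The first conjunct is the invariant; for the empty sum it is `A n ∈ U`.
  have key : ∀ α : Finset ℕ, (∀ i ∈ α, n ≤ i) →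
      ((∀ᶠ e in U, ∑ i ∈ α, d i + e ∈ A n) ∧ (α.Nonempty → ∑ i ∈ α, d i ∈ A n)) := by
    intro α
    induction α using Finset.induction_on_max with
    | empty => exact fun _ => ⟨by simpa using hA n, by simp⟩
    | insert m β hβ ih =>
      intro hm
      obtain ⟨h1, -⟩ := ih fun i hi => hm i (Finset.mem_insert_of_mem hi)
      obtain ⟨h, hh, hRm⟩ := hR m
      have hsum : ∑ i ∈ β, h i = ∑ i ∈ β, d i := Finset.sum_congr rfl fun i hi => hh i (hβ i hi)
      have := hRm β (Finset.mem_powerset.2 fun i hi => Finset.mem_range.2 (hβ i hi)) n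
        (hm m (Finset.mem_insert_self m β)) (by rwa [hsum])
      rw [Finset.sum_insert fun hmem => (hβ m hmem).false, add_comm (d m), ← hsum]
      exact ⟨this.2, fun _ => this.1⟩
  exact (key β hβn).2 hβ

theorem hasDiagonalUltrafilters_finiteSums : HasDiagonalUltrafilters finiteSums := by
  intro E hE
  obtain ⟨U, hadd, hU⟩ := exists_additive_ultrafilter hE
  have hcof := le_cofinite_of_finiteSums_mem hU
  exact ⟨U, hcof, hU, additive_ultrafilter_diagonal hadd hcof⟩

theorem finiteSums_mono : Monotone finiteSums :=
  fun _ _ h _ ⟨α, hα, hαD, hx⟩ => ⟨α, hα, hαD.trans h, hx⟩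

theorem pairsOf_mono : Monotone pairsOf :=
  fun _ _ h _ hs => Set.Subset.trans hs h

theorem posDifferences_mono : Monotone posDifferences :=
  fun _ _ h _ ⟨a, ha, b, hb, hab⟩ => ⟨a, h ha, b, h hb, hab⟩

/-! ### The transfinite construction of an orthogonal family. -/

/-- A property of countable families that can be extended to meet any one of `ℵ₁` requirements,
and that passes to unions of chains, is shared by a family meeting all the requirements. -/
theorem exists_of_countable_extensions {X T : Type} (hT : #T ≤ ℵ₁) (Good : Set X → Prop)
    (Q : T → Set X → Prop) (hQ : ∀ t, ∀ C C' : Set X, C ⊆ C' → Q t C → Q t C')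
    (hext : ∀ C : Set X, C.Countable → Good C → ∀ t,
      ∃ C', C ⊆ C' ∧ C'.Countable ∧ Good C' ∧ Q t C')
    (hchain : ∀ 𝒞 : Set (Set X), IsChain (· ⊆ ·) 𝒞 → (∀ C ∈ 𝒞, Good C) → Good (⋃₀ 𝒞)) :
    ∃ C, Good C ∧ ∀ t, Q t C := by
  classical
  -- Pulling back the order of `ω₁` makes every requirement have only countably many predecessors.
  obtain ⟨e⟩ : Nonempty (T ↪ (ℵ₁ : Cardinal.{0}).ord.ToType) := by
    rw [← Cardinal.le_def]
    simpa using hT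
  have hcount : ∀ t, {s | e s < e t}.Countable := by
    intro t
    have h1 : (Iio (e t)).Countable := by
      rw [← Cardinal.le_aleph0_iff_set_countable, ← Order.lt_succ_iff, Cardinal.succ_aleph0]
      simpa using Cardinal.mk_Iio_lt (e t) (by simp)
    exact h1.preimage e.injective
  have hwf : WellFounded fun s t : T => e s < e t := InvImage.wf e wellFounded_lt
  let ext : Set X → T → Set X := fun C t =>
    if h : C.Countable ∧ Good C then (hext C h.1 h.2 t).choose else ∅
  have ext_spec : ∀ C t, C.Countable → Good C →
      C ⊆ ext C t ∧ (ext C t).Countable ∧ Good (ext C t) ∧ Q t (ext C t) := by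
    intro C t h1 h2
    have : ext C t = (hext C h1 h2 t).choose := dif_pos ⟨h1, h2⟩
    rw [this]
    exact (hext C h1 h2 t).choose_spec
  let G : T → Set X := hwf.fix fun t ih => ext (⋃ s, ⋃ h : e s < e t, ih s h) t
  have hG : ∀ t, G t = ext (⋃ s, ⋃ _ : e s < e t, G s) t := fun t => hwf.fix_eq _ t
  -- Stated for arbitrary `W`: initial segments are needed inside the induction, all of `T` at the
  -- end.
  have isChain_of : ∀ W : Set T,
      (∀ t ∈ W, (⋃ s, ⋃ _ : e s < e t, G s) ⊆ G t) → IsChain (· ⊆ ·) (G '' W) := by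
    rintro W hW _ ⟨s, hs, rfl⟩ _ ⟨t, ht, rfl⟩ -
    rcases lt_trichotomy (e s) (e t) with h | h | h
    · exact Or.inl ((subset_iUnion₂ (s := fun s (_ : e s < e t) => G s) s h).trans (hW t ht))
    · rw [e.injective h]
      exact Or.inl subset_rfl
    · exact Or.inr ((subset_iUnion₂ (s := fun t (_ : e t < e s) => G t) t h).trans (hW s hs))
  have key : ∀ t, (⋃ s, ⋃ _ : e s < e t, G s) ⊆ G t ∧ (G t).Countable ∧ Good (G t) ∧
      Q t (G t) := by
    intro t
    induction t using hwf.induction with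
    | _ t ih =>
      have h1 : (⋃ s, ⋃ _ : e s < e t, G s).Countable :=
        (hcount t).biUnion fun s hs => (ih s hs).2.1
      have h2 : Good (⋃ s, ⋃ _ : e s < e t, G s) := by
        have := hchain (G '' {s | e s < e t}) (isChain_of _ fun s hs => (ih s hs).1) (by
          rintro _ ⟨s, hs, rfl⟩
          exact (ih s hs).2.2.1)
        rwa [sUnion_image] at this
      have h3 := ext_spec _ t h1 h2
      rwa [← hG t] at h3
  refine ⟨⋃₀ (G '' univ), hchain _ (isChain_of _ fun t _ => (key t).1) ?_, fun t => ?_⟩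
  · rintro _ ⟨t, -, rfl⟩
    exact (key t).2.2.1
  · exact hQ t _ _ (subset_sUnion_of_mem ⟨t, mem_univ t, rfl⟩) (key t).2.2.2

/-- `f` maps the sets `ρ (D \ K)`, `K` finite, eventually into each `S m`. -/
def ConvergesAlong {Λ : Type*} (ρ : Set ℕ → Set Λ) (f : Λ → ℕ) (D : Set ℕ)
    (S : ℕ → Set ℕ) : Prop :=
  ∀ m, ∃ K : Set ℕ, K.Finite ∧ f '' ρ (D \ K) ⊆ S m

/-- The sequence of final segments of a set of natural numbers. -/
def tails (B : Set ℕ) (m : ℕ) : Set ℕ := B \ Iio m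

theorem tails_zero (B : Set ℕ) : tails B 0 = B := by simp [tails]

theorem tails_injective : Function.Injective tails := fun B B' h => by
  rw [← tails_zero B, h, tails_zero]

/-- Some terms of the two sequences are disjoint. -/
def EventuallyDisjoint (S T : ℕ → Set ℕ) : Prop := ∃ m n, Disjoint (S m) (T n)

theorem EventuallyDisjoint.symm {S T : ℕ → Set ℕ} (h : EventuallyDisjoint S T) :
    EventuallyDisjoint T S :=
  let ⟨m, n, hmn⟩ := h
  ⟨n, m, hmn.symm⟩

/-- A family of sequences of sets in `I`, each with empty intersection, that are pairwise
eventually disjoint. -/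
structure IsOrthogonalFamily (I : Set (Set ℕ)) (C : Set (ℕ → Set ℕ)) : Prop where
  mem : ∀ S ∈ C, S 0 ∈ I
  vanish : ∀ S ∈ C, ∀ k, ∃ m, k ∉ S m
  pairwise : C.Pairwise EventuallyDisjoint

namespace IsOrthogonalFamily

theorem insert {I : Set (Set ℕ)} {C : Set (ℕ → Set ℕ)} (hC : IsOrthogonalFamily I C)
    {S : ℕ → Set ℕ} (h0 : S 0 ∈ I) (h1 : ∀ k, ∃ m, k ∉ S m)
    (h2 : ∀ T ∈ C, EventuallyDisjoint S T) : IsOrthogonalFamily I (insert S C) where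
  mem := by
    rintro T (rfl | hT)
    exacts [h0, hC.mem T hT]
  vanish := by
    rintro T (rfl | hT)
    exacts [h1, hC.vanish T hT]
  pairwise := hC.pairwise.insert fun T hT _ => ⟨h2 T hT, (h2 T hT).symm⟩

theorem sUnion {I : Set (Set ℕ)} {𝒞 : Set (Set (ℕ → Set ℕ))} (hc : IsChain (· ⊆ ·) 𝒞)
    (h : ∀ C ∈ 𝒞, IsOrthogonalFamily I C) : IsOrthogonalFamily I (⋃₀ 𝒞) where
  mem := fun S ⟨C, hC, hS⟩ => (h C hC).mem S hS
  vanish := fun S ⟨C, hC, hS⟩ => (h C hC).vanish S hS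
  pairwise := (pairwise_sUnion hc.directedOn).2 fun C hC => (h C hC).pairwise

end IsOrthogonalFamily

theorem exists_extension_convergesAlong {Λ : Type} {ρ : Set ℕ → Set Λ}
    (hρ : HasDiagonalUltrafilters ρ) {I : Set (Set ℕ)} (hI : IsIdealOn I)
    (hK : ¬ KatetovLE I (idealOf ρ)) {C : Set (ℕ → Set ℕ)} (hCc : C.Countable)
    (hC : IsOrthogonalFamily I C) (f : Λ → ℕ) :
    ∃ C', C ⊆ C' ∧ C'.Countable ∧ IsOrthogonalFamily I C' ∧
      ∃ D : Set ℕ, D.Infinite ∧ ((∃ n, ConvergesAlong ρ f D fun _ => {n}) ∨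
        ∃ S ∈ C', ConvergesAlong ρ f D S) := by
  classical
  -- Otherwise `f` itself would witness `KatetovLE I (idealOf ρ)`.
  obtain ⟨D₀, hD₀, hfD₀⟩ : ∃ D₀ : Set ℕ, D₀.Infinite ∧ f '' ρ D₀ ∈ I := by
    by_contra! hcon
    refine hK ⟨f, fun A hA hfA => ?_⟩
    simp only [idealOf, mem_ofPred_eq, not_forall, not_not] at hA
    obtain ⟨D, hD, hDA⟩ := hA
    exact hcon D hD (hI.subset_mem _ _ (image_mono hDA) hfA)
  obtain ⟨p, -, hpD₀, hp⟩ := hρ D₀ hD₀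
  have hpD₀' : ρ D₀ ∈ p := by simpa using hpD₀ ∅ finite_empty
  by_cases h1 : ∃ n, f ⁻¹' {n} ∈ p
  · obtain ⟨n, hn⟩ := h1
    obtain ⟨D, hD, hDn⟩ := hp (fun _ => f ⁻¹' {n}) fun _ => hn
    refine ⟨C, subset_rfl, hCc, hC, D, hD, Or.inl ⟨n, fun m => ?_⟩⟩
    obtain ⟨K, hK, h⟩ := hDn m
    exact ⟨K, hK, image_subset_iff.2 h⟩
  by_cases h2 : ∃ S ∈ C, ∀ m, f ⁻¹' S m ∈ p
  · obtain ⟨S, hS, hSp⟩ := h2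
    obtain ⟨D, hD, hDn⟩ := hp (fun m => f ⁻¹' S m) hSp
    refine ⟨C, subset_rfl, hCc, hC, D, hD, Or.inr ⟨S, hS, fun m => ?_⟩⟩
    obtain ⟨K, hK, h⟩ := hDn m
    exact ⟨K, hK, image_subset_iff.2 h⟩
  push Not at h1 h2
  choose! N hN using h2
  -- One term of each `S ∈ C` with preimage outside `p`, listed as `g`; constantly `∅` if `C` is
  -- empty.
  obtain ⟨g, hg⟩ : ∃ g : ℕ → Set ℕ, (∀ j, f ⁻¹' (g j)ᶜ ∈ p) ∧
      ∀ S ∈ C, ∃ j, S (N S) = g j := by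
    rcases C.eq_empty_or_nonempty with rfl | hne
    · refine ⟨fun _ => ∅, fun _ => ?_, by simp⟩
      rw [compl_empty, preimage_univ]
      exact univ_mem
    · obtain ⟨s, hs⟩ := hCc.exists_eq_range hne
      refine ⟨fun j => s j (N (s j)), fun j => ?_, fun S hS => ?_⟩
      · rw [preimage_compl]
        exact Ultrafilter.compl_mem_iff_notMem.2 (hN (s j) (hs ▸ mem_range_self j))
      · rw [hs] at hS
        obtain ⟨j, rfl⟩ := hS
        exact ⟨j, rfl⟩
  -- Removing the values up to `m` makes the new sequence vanish; removing `g 0, ..., g m` makes it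
  -- orthogonal to `C`; `ρ D₀` keeps its first term in `I`.
  let A : ℕ → Set Λ := fun m => ρ D₀ ∩ ⋂ j ∈ Iic m, (f ⁻¹' {j}ᶜ ∩ f ⁻¹' (g j)ᶜ)
  have hA : ∀ m, A m ∈ p := fun m => inter_mem hpD₀' <|
    (biInter_mem (finite_Iic m)).2 fun j _ => inter_mem
      (by rw [preimage_compl]; exact Ultrafilter.compl_mem_iff_notMem.2 (h1 j)) (hg.1 j)
  obtain ⟨D, hD, hDA⟩ := hp A hA
  refine ⟨insert (fun m => f '' A m) C, subset_insert _ _, hCc.insert _, hC.insert ?_ ?_ ?_, D, hD,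
    Or.inr ⟨_, mem_insert _ _, fun m => ?_⟩⟩
  · exact hI.subset_mem _ _ (image_mono inter_subset_left) hfD₀
  · rintro k
    refine ⟨k, ?_⟩
    rintro ⟨x, hx, rfl⟩
    have := mem_iInter₂.1 hx.2 (f x) (mem_Iic.2 le_rfl)
    exact this.1 rfl
  · intro S hS
    obtain ⟨j, hj⟩ := hg.2 S hS
    refine ⟨j, N S, ?_⟩
    rw [Set.disjoint_left, hj]
    rintro _ ⟨x, hx, rfl⟩
    exact (mem_iInter₂.1 hx.2 j (mem_Iic.2 le_rfl)).2
  · obtain ⟨K, hK, h⟩ := hDA m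
    exact ⟨K, hK, image_mono h⟩

theorem IsIdealOn.infinite_of_notMem {Λ : Type*} {I : Set (Set Λ)} (hI : IsIdealOn I)
    {A : Set Λ} (hA : A ∉ I) : A.Infinite :=
  fun h => hA (hI.finite_mem A h)

theorem IsIdealOn.sdiff_notMem {Λ : Type*} {I : Set (Set Λ)} (hI : IsIdealOn I)
    {A B : Set Λ} (hA : A ∉ I) (hB : B ∈ I) : A \ B ∉ I := fun h =>
  hA (hI.subset_mem _ _ (fun x hx => by by_cases hxB : x ∈ B <;> simp [hx, hxB])
    (hI.union_mem _ _ h hB))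

theorem IsIdealOn.biUnion_mem {Λ : Type*} {I : Set (Set Λ)} (hI : IsIdealOn I) (S : ℕ → Set Λ)
    (hS : ∀ j, S j ∈ I) (n : ℕ) : ⋃ j ∈ Iio n, S j ∈ I := by
  induction n with
  | zero => simpa using hI.finite_mem ∅ finite_empty
  | succ n ih =>
    refine hI.subset_mem _ _ ?_ (hI.union_mem _ _ ih (hS n))
    refine iUnion₂_subset fun j hj => ?_
    rcases Nat.lt_succ_iff_lt_or_eq.1 hj with h | rfl
    · exact (subset_biUnion_of_mem (u := S) (mem_Iio.2 h)).trans subset_union_left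
    · exact subset_union_right

/-- An ideal that is not below `idealOf ρ` is tall. -/
theorem exists_infinite_subset_mem {Λ : Type} [Countable Λ] {ρ : Set ℕ → Set Λ}
    (hρ : HasDiagonalUltrafilters ρ) {I : Set (Set ℕ)}
    (hK : ¬ KatetovLE I (idealOf ρ)) {B : Set ℕ} (hB : B.Infinite) :
    ∃ B' ⊆ B, B'.Infinite ∧ B' ∈ I := by
  by_contra! hcon
  obtain ⟨e, he⟩ := exists_injective_nat Λ
  -- If no infinite subset of `B` were in `I`, any injection of `Λ` into `B` would witness the
  -- Katetov relation.
  let φ : Λ → ℕ := fun x => Nat.nth (· ∈ B) (e x)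
  have hφ : Function.Injective φ := (Nat.nth_injective hB).comp he
  refine hK ⟨φ, fun A hA => ?_⟩
  simp only [idealOf, mem_ofPred_eq, not_forall, not_not] at hA
  obtain ⟨D, hD, hDA⟩ := hA
  obtain ⟨p, hp, hpD, -⟩ := hρ D hD
  have hpA : A ∈ p := mem_of_superset (by simpa using hpD ∅ finite_empty) hDA
  have hAinf : A.Infinite := fun hfin => by
    have := hfin.eventually_notMem_of_le hp
    exact Ultrafilter.compl_notMem_iff.2 hpA this
  refine hcon _ ?_ (hAinf.image hφ.injOn)
  rintro _ ⟨x, -, rfl⟩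
  exact Nat.nth_mem_of_infinite hB _

/-- `A` minus finitely many of the sets `S 0 ∈ I` stays outside `I`, hence infinite, so some
infinite subset of `A` is almost disjoint from every `S 0`; tallness shrinks it into `I`. -/
theorem exists_extension_tails {I : Set (Set ℕ)} (hI : IsIdealOn I)
    (htall : ∀ B : Set ℕ, B.Infinite → ∃ B' ⊆ B, B'.Infinite ∧ B' ∈ I)
    {C : Set (ℕ → Set ℕ)} (hCc : C.Countable) (hC : IsOrthogonalFamily I C) {A : Set ℕ}
    (hA : A ∉ I) :
    ∃ C', C ⊆ C' ∧ C'.Countable ∧ IsOrthogonalFamily I C' ∧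
      ∃ B ⊆ A, B.Infinite ∧ tails B ∈ C' := by
  obtain ⟨g, hg⟩ : ∃ g : ℕ → Set ℕ, (∀ j, g j ∈ I) ∧ ∀ S ∈ C, ∃ j, S 0 = g j := by
    rcases C.eq_empty_or_nonempty with rfl | hne
    · exact ⟨fun _ => ∅, fun _ => hI.finite_mem ∅ finite_empty, by simp⟩
    · obtain ⟨s, hs⟩ := hCc.exists_eq_range hne
      refine ⟨fun j => s j 0, fun j => hC.mem _ (hs ▸ mem_range_self j), fun S hS => ?_⟩
      rw [hs] at hS
      obtain ⟨j, rfl⟩ := hS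
      exact ⟨j, rfl⟩
  obtain ⟨b, hb, hbA⟩ := extraction_forall_of_frequently
    (P := fun n k => k ∈ A \ ⋃ j ∈ Iio n, g j) fun n => Nat.frequently_atTop_iff_infinite.2
      (hI.infinite_of_notMem (hI.sdiff_notMem hA (hI.biUnion_mem g hg.1 n)))
  obtain ⟨B, hBb, hB, hBI⟩ := htall (range b) (infinite_range_of_injective hb.injective)
  refine ⟨insert (tails B) C, subset_insert _ _, hCc.insert _, hC.insert ?_ ?_ ?_, B, ?_, hB,
    mem_insert _ _⟩
  · rwa [tails_zero]
  · exact fun k => ⟨k + 1, fun h => h.2 (Nat.lt_succ_self k)⟩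
  · intro S hS
    obtain ⟨j, hj⟩ := hg.2 S hS
    -- `b n` avoids `g j` only when `j < n`, so the cut comes at index `j + 1`.
    refine ⟨b (j + 1), 0, ?_⟩
    rw [Set.disjoint_left, hj]
    rintro x ⟨hx, hxj⟩ hxg
    obtain ⟨n, rfl⟩ := hBb hx
    have : j < n := by
      by_contra h
      exact hxj (hb (by omega : n < j + 1))
    exact (hbA n).2 (mem_biUnion this hxg)
  · intro x hx
    obtain ⟨n, rfl⟩ := hBb hx
    exact (hbA n).1

theorem exists_orthogonalFamily (hCH : (ℵ₁ : Cardinal.{0}) = 𝔠) {Λ : Type} [Countable Λ]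
    {ρ : Set ℕ → Set Λ} (hρ : HasDiagonalUltrafilters ρ) {I : Set (Set ℕ)} (hI : IsIdealOn I)
    (hK : ¬ KatetovLE I (idealOf ρ)) :
    ∃ C, IsOrthogonalFamily I C ∧
      (∀ f : Λ → ℕ, ∃ D : Set ℕ, D.Infinite ∧ ((∃ n, ConvergesAlong ρ f D fun _ => {n}) ∨
        ∃ S ∈ C, ConvergesAlong ρ f D S)) ∧
      ∀ A ∉ I, ∃ B ⊆ A, B.Infinite ∧ tails B ∈ C := by
  -- A requirement is a pair `(f, A)`, treating both tasks at once.
  have hT : #((Λ → ℕ) × Set ℕ) ≤ ℵ₁ := by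
    have h1 : #(Λ → ℕ) ≤ 𝔠 := by
      rw [← Cardinal.power_def, mk_nat, ← aleph0_power_aleph0]
      exact Cardinal.power_le_power_left aleph0_ne_zero (mk_le_aleph0 (α := Λ))
    have h2 : #(Set ℕ) ≤ 𝔠 := by simp
    rw [hCH, Cardinal.mk_prod, lift_id, lift_id]
    exact (mul_le_mul' h1 h2).trans_eq continuum_mul_self
  obtain ⟨C, hC, hQ⟩ := exists_of_countable_extensions hT (IsOrthogonalFamily I)
    (fun t C => (∃ D : Set ℕ, D.Infinite ∧ ((∃ n, ConvergesAlong ρ t.1 D fun _ => {n}) ∨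
        ∃ S ∈ C, ConvergesAlong ρ t.1 D S)) ∧ (t.2 ∉ I → ∃ B ⊆ t.2, B.Infinite ∧ tails B ∈ C))
    (fun t C C' hCC' h => ⟨by
      obtain ⟨D, hD, h' | ⟨S, hS, h'⟩⟩ := h.1
      exacts [⟨D, hD, Or.inl h'⟩, ⟨D, hD, Or.inr ⟨S, hCC' hS, h'⟩⟩], fun hA => by
      obtain ⟨B, hBA, hB, hBC⟩ := h.2 hA
      exact ⟨B, hBA, hB, hCC' hBC⟩⟩)
    (by
      rintro C hCc hC ⟨f, A⟩
      obtain ⟨C₁, hCC₁, hC₁c, hC₁, D, hD, h⟩ := exists_extension_convergesAlong hρ hI hK hCc hC f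
      by_cases hA : A ∈ I
      · exact ⟨C₁, hCC₁, hC₁c, hC₁, ⟨D, hD, h⟩, fun h => absurd hA h⟩
      · obtain ⟨C₂, hCC₂, hC₂c, hC₂, hB⟩ := exists_extension_tails hI
          (fun B hB => exists_infinite_subset_mem hρ hK hB) hC₁c hC₁ hA
        refine ⟨C₂, hCC₁.trans hCC₂, hC₂c, hC₂, ⟨D, hD, ?_⟩, fun _ => hB⟩
        exact h.imp_right fun ⟨S, hS, h'⟩ => ⟨S, hCC₂ hS, h'⟩)
    (fun 𝒞 hc h => IsOrthogonalFamily.sUnion hc h)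
  exact ⟨C, hC, fun f => (hQ (f, ∅)).1, fun A hA => (hQ (fun _ => 0, A)).2 hA⟩

/-- The almost disjoint family of an orthogonal family. -/
def almostDisjointPart (C : Set (ℕ → Set ℕ)) : Set (Set ℕ) := {B | B.Infinite ∧ tails B ∈ C}

theorem IsOrthogonalFamily.isAlmostDisjoint {I : Set (Set ℕ)} {C : Set (ℕ → Set ℕ)}
    (hC : IsOrthogonalFamily I C) : IsAlmostDisjoint (almostDisjointPart C) := by
  refine ⟨fun A hA => hA.1, fun A hA B hB hAB => ?_⟩
  obtain ⟨m, n, hmn⟩ := hC.pairwise hA.2 hB.2 (tails_injective.ne hAB)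
  refine (finite_Iio (max m n)).subset fun x hx => ?_
  by_contra h
  rw [mem_Iio, not_lt, max_le_iff] at h
  exact Set.disjoint_left.1 hmn ⟨hx.1, not_lt.2 h.1⟩ ⟨hx.2, not_lt.2 h.2⟩

/-- If `s` listed the family, two disjoint sets could each be made to meet every `s n`. Their
complements contain no member of the family, so both lie in `I`, yet they cover `ℕ`. -/
theorem not_countable_of_forall_exists_subset {I : Set (Set ℕ)} (hI : IsIdealOn I)
    {𝒜 : Set (Set ℕ)} (hinf : ∀ B ∈ 𝒜, B.Infinite) (h : ∀ A ∉ I, ∃ B ∈ 𝒜, B ⊆ A) :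
    ¬ 𝒜.Countable := by
  intro hc
  obtain ⟨B₀, hB₀, -⟩ := h univ hI.univ_notMem
  obtain ⟨s, hs⟩ := hc.exists_eq_range ⟨B₀, hB₀⟩
  -- Halving the index puts both `b (2n)` and `b (2n + 1)` in `s n`, one for each set.
  obtain ⟨b, hb, hbs⟩ := extraction_forall_of_frequently
    (P := fun n k => k ∈ s (n / 2)) fun n => Nat.frequently_atTop_iff_infinite.2
      (hinf _ (hs ▸ mem_range_self _))
  have key : ∀ r < 2, (range fun n => b (2 * n + r))ᶜ ∈ I := by
    intro r hr
    by_contra hcon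
    obtain ⟨B, hB, hBr⟩ := h _ hcon
    rw [hs] at hB
    obtain ⟨n, rfl⟩ := hB
    have := hbs (2 * n + r)
    rw [show (2 * n + r) / 2 = n by omega] at this
    exact hBr this ⟨n, rfl⟩
  refine hI.univ_notMem (hI.subset_mem _ _ (fun x _ => ?_)
    (hI.union_mem _ _ (key 0 (by norm_num)) (key 1 (by norm_num))))
  by_contra hx
  simp only [mem_union, mem_compl_iff, not_or, not_not, mem_range] at hx
  obtain ⟨⟨m, hm⟩, ⟨n, hn⟩⟩ := hx
  have := hb.injective (hm.trans hn.symm)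
  omega

/-! ### Mrowka spaces, their compactifications, and convergence in them. -/

theorem exists_finite_forall_of_finite {Λ ι : Type*} {ρ : Set ℕ → Set Λ} (hmono : Monotone ρ)
    {D : Set ℕ} {t : Set ι} (ht : t.Finite) {P : ι → Λ → Prop}
    (h : ∀ i ∈ t, ∃ K : Set ℕ, K.Finite ∧ ∀ y ∈ ρ (D \ K), P i y) :
    ∃ K : Set ℕ, K.Finite ∧ ∀ y ∈ ρ (D \ K), ∀ i ∈ t, P i y := by
  choose! K hK hP using h
  exact ⟨⋃ i ∈ t, K i, ht.biUnion hK, fun y hy i hi => hP i hi y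
    (hmono (sdiff_subset_sdiff_right (subset_biUnion_of_mem (u := K) hi)) hy)⟩

namespace MrowkaSpace

variable {𝒜 : Set (Set ℕ)}

theorem isOpen_iff {U : Set (MrowkaSpace 𝒜)} : IsOpen U ↔ ∀ A : 𝒜, mem A ∈ U →
    ∃ F : Set ℕ, F.Finite ∧ ∀ n ∈ (A : Set ℕ) \ F, nat n ∈ U := Iff.rfl

theorem isOpen_nat_image (S : Set ℕ) : IsOpen (nat '' S : Set (MrowkaSpace 𝒜)) := by
  rw [isOpen_iff]
  rintro A ⟨n, -, hn⟩
  cases hn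

theorem isOpen_insert_mem (A : 𝒜) {F : Set ℕ} (hF : F.Finite) :
    IsOpen (insert (mem A) (nat '' ((A : Set ℕ) \ F)) : Set (MrowkaSpace 𝒜)) := by
  rw [isOpen_iff]
  rintro B (hB | ⟨n, -, hn⟩)
  · cases hB
    exact ⟨F, hF, fun n hn => Or.inr ⟨n, hn, rfl⟩⟩
  · cases hn

/-- A neighbourhood of each point: `{n}` for `n ∈ ω` and `{A} ∪ A` for `A ∈ 𝒜`. -/
def basicNhd : MrowkaSpace 𝒜 → Set (MrowkaSpace 𝒜)
  | nat n => {nat n}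
  | mem A => insert (mem A) (nat '' (A : Set ℕ))

theorem basicNhd_mem_nhds (x : MrowkaSpace 𝒜) : basicNhd x ∈ 𝓝 x := by
  cases x with
  | nat n =>
    have := (isOpen_nat_image (𝒜 := 𝒜) {n}).mem_nhds ⟨n, rfl, rfl⟩
    rwa [image_singleton] at this
  | mem A =>
    have := (isOpen_insert_mem A finite_empty).mem_nhds (mem_insert _ _)
    rwa [sdiff_empty] at this

theorem tendsto_nat (A : 𝒜) :
    Tendsto (fun n : (A : Set ℕ) => (nat (n : ℕ) : MrowkaSpace 𝒜)) cofinite (𝓝 (mem A)) := by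
  intro V hV
  obtain ⟨U, hUV, hU, hAU⟩ := mem_nhds_iff.1 hV
  obtain ⟨F, hF, h⟩ := isOpen_iff.1 hU A hAU
  refine (hF.preimage Subtype.val_injective.injOn).subset fun n hn => ?_
  by_contra hnF
  exact hn (hUV (h n ⟨n.2, hnF⟩))

theorem isCompact_basicNhd (x : MrowkaSpace 𝒜) : IsCompact (basicNhd x) := by
  cases x with
  | nat n => exact isCompact_singleton
  | mem A =>
    have := (tendsto_nat A).isCompact_insert_range_of_cofinite
    rwa [range_comp' nat Subtype.val, Subtype.range_coe] at this

/-- Local compactness is what makes the one-point compactification Hausdorff. -/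
instance : WeaklyLocallyCompactSpace (MrowkaSpace 𝒜) :=
  ⟨fun x => ⟨basicNhd x, isCompact_basicNhd x, basicNhd_mem_nhds x⟩⟩

theorem exists_tails_of_mem_nhds {A : 𝒜} {V : Set (MrowkaSpace 𝒜)} (hV : V ∈ 𝓝 (mem A)) :
    ∃ m, ∀ n ∈ tails A m, nat n ∈ V := by
  obtain ⟨U, hUV, hU, hAU⟩ := mem_nhds_iff.1 hV
  obtain ⟨F, hF, h⟩ := isOpen_iff.1 hU A hAU
  obtain ⟨m, hm⟩ := hF.bddAbove
  exact ⟨m + 1, fun n hn => hUV (h n ⟨hn.1, fun hnF => hn.2 (Nat.lt_succ_of_le (hm hnF))⟩)⟩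

theorem t2Space (h𝒜 : IsAlmostDisjoint 𝒜) : T2Space (MrowkaSpace 𝒜) := by
  have nat_mem : ∀ (n : ℕ) (A : 𝒜), ∃ U V : Set (MrowkaSpace 𝒜), IsOpen U ∧ IsOpen V ∧
      nat n ∈ U ∧ mem A ∈ V ∧ Disjoint U V := fun n A => by
    refine ⟨_, _, isOpen_nat_image {n}, isOpen_insert_mem A (finite_singleton n),
      ⟨n, rfl, rfl⟩, mem_insert _ _, ?_⟩
    rw [Set.disjoint_left]
    rintro _ ⟨k, rfl, rfl⟩ (h | ⟨l, hl, hlk⟩)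
    · cases h
    · cases hlk
      exact hl.2 rfl
  refine ⟨fun x y hxy => ?_⟩
  cases x with
  | nat n =>
    cases y with
    | nat k =>
      refine ⟨_, _, isOpen_nat_image {n}, isOpen_nat_image {k}, ⟨n, rfl, rfl⟩, ⟨k, rfl, rfl⟩, ?_⟩
      simpa using hxy
    | mem A => exact nat_mem n A
  | mem A =>
    cases y with
    | nat n =>
      obtain ⟨U, V, hU, hV, hn, hA, hUV⟩ := nat_mem n A
      exact ⟨V, U, hV, hU, hA, hn, hUV.symm⟩
    | mem B =>
      have hAB : (A : Set ℕ) ≠ B := fun h => hxy (by rw [Subtype.ext h])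
      refine ⟨_, _, isOpen_insert_mem A finite_empty,
        isOpen_insert_mem B (h𝒜.2 A A.2 B B.2 hAB), mem_insert _ _, mem_insert _ _, ?_⟩
      rw [Set.disjoint_left]
      rintro _ (rfl | ⟨k, hk, rfl⟩) (h | ⟨l, hl, hlk⟩)
      · exact hxy h
      · cases hlk
      · cases h
      · cases hlk
        exact hl.2 ⟨hk.1, hl.1⟩

end MrowkaSpace

namespace FranklinSpace

open MrowkaSpace

variable {𝒜 : Set (Set ℕ)}

theorem t2Space (h𝒜 : IsAlmostDisjoint 𝒜) : T2Space (FranklinSpace 𝒜) := by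
  have := MrowkaSpace.t2Space h𝒜
  infer_instance

theorem separableSpace (h𝒜 : ∀ A ∈ 𝒜, A.Infinite) :
    TopologicalSpace.SeparableSpace (FranklinSpace 𝒜) := by
  refine ⟨insert OnePoint.infty (range fun n => ((nat n : MrowkaSpace 𝒜) : FranklinSpace 𝒜)),
    (countable_range _).insert _, fun x => ?_⟩
  induction x using OnePoint.rec with
  | infty => exact subset_closure (mem_insert _ _)
  | coe x =>
    cases x with
    | nat n => exact subset_closure (Or.inr ⟨n, rfl⟩)
    | mem A =>
      have : Infinite (A : Set ℕ) := (h𝒜 A A.2).to_subtype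
      refine mem_closure_of_tendsto
        ((OnePoint.continuous_coe.tendsto (mem A)).comp (tendsto_nat A)) ?_
      exact Eventually.of_forall fun n => Or.inr ⟨n, rfl⟩

theorem mk_eq_continuum (hCH : (ℵ₁ : Cardinal.{0}) = 𝔠) (h𝒜 : ¬ 𝒜.Countable) :
    #(FranklinSpace 𝒜) = 𝔠 := by
  have e : MrowkaSpace 𝒜 ≃ ℕ ⊕ 𝒜 :=
    { toFun := fun x => match x with
        | nat n => Sum.inl n
        | mem A => Sum.inr A
      invFun := Sum.elim nat mem
      left_inv := fun x => by cases x <;> rfl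
      right_inv := fun x => by cases x <;> rfl }
  have h1 : #𝒜 = 𝔠 := by
    refine le_antisymm ((mk_set_le 𝒜).trans (by simp)) ?_
    rw [← hCH, ← succ_aleph0, Order.succ_le_iff, ← not_le, Cardinal.le_aleph0_iff_set_countable]
    exact h𝒜
  change #(Option (MrowkaSpace 𝒜)) = 𝔠
  rw [mk_option, e.cardinal_eq]
  simpa [h1] using add_eq_left aleph0_le_continuum (one_le_aleph0.trans aleph0_le_continuum)

/-- A compact subset of the Mrowka space is covered by finitely many `basicNhd x`, so it suffices to
leave each of these. -/
theorem rhoConverges_infty {Λ : Type*} {ρ : Set ℕ → Set Λ} (hmono : Monotone ρ)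
    {f : Λ → FranklinSpace 𝒜} {D : Set ℕ}
    (h : ∀ x : MrowkaSpace 𝒜, ∃ K : Set ℕ, K.Finite ∧ ∀ y ∈ ρ (D \ K),
      f y ∉ ((↑) : MrowkaSpace 𝒜 → FranklinSpace 𝒜) '' basicNhd x) :
    RhoConverges ρ f D OnePoint.infty := by
  intro U hU
  obtain ⟨s, ⟨-, hs⟩, hsU⟩ := OnePoint.hasBasis_nhds_infty.mem_iff.1 hU
  obtain ⟨t, -, hst⟩ := hs.elim_nhds_subcover basicNhd fun x _ => basicNhd_mem_nhds x
  obtain ⟨K, hK, hKt⟩ := exists_finite_forall_of_finite hmono t.finite_toSet fun x _ => h x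
  refine ⟨K, hK, ?_⟩
  rintro _ ⟨y, hy, rfl⟩
  refine hsU ?_
  induction hz : f y using OnePoint.rec with
  | infty => exact Or.inr rfl
  | coe z =>
    refine Or.inl ⟨z, fun hzs => ?_, rfl⟩
    obtain ⟨x, hx, hzx⟩ := mem_iUnion₂.1 (hst hzs)
    exact hKt y hy x hx ⟨z, hzx, hz.symm⟩

/-- If `S = tails B`, the limit is the point `B`. Any other `S` vanishes and is eventually disjoint
from every `tails B`, so the limit is infinity. -/
theorem exists_rhoConverges_nat {Λ : Type*} {ρ : Set ℕ → Set Λ} (hmono : Monotone ρ)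
    {I : Set (Set ℕ)} {C : Set (ℕ → Set ℕ)} (hC : IsOrthogonalFamily I C)
    {g : Λ → ℕ} {D : Set ℕ} (h : (∃ n, ConvergesAlong ρ g D fun _ => {n}) ∨
        ∃ S ∈ C, ConvergesAlong ρ g D S) :
    ∃ x, RhoConverges ρ
      (fun y => OnePoint.some (nat (g y) : MrowkaSpace (almostDisjointPart C))) D x := by
  rcases h with ⟨n, hn⟩ | ⟨S, hS, hgS⟩
  · refine ⟨OnePoint.some (nat n : MrowkaSpace (almostDisjointPart C)), fun U hU => ?_⟩
    obtain ⟨K, hK, hKn⟩ := hn 0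
    refine ⟨K, hK, ?_⟩
    rintro _ ⟨y, hy, rfl⟩
    have : g y = n := hKn ⟨y, hy, rfl⟩
    simpa only [this] using mem_of_mem_nhds hU
  by_cases hB : ∃ B : Set ℕ, B.Infinite ∧ tails B = S
  · obtain ⟨B, hB, rfl⟩ := hB
    let B' : almostDisjointPart C := ⟨B, hB, hS⟩
    refine ⟨OnePoint.some (mem B' : MrowkaSpace (almostDisjointPart C)), fun U hU => ?_⟩
    rw [OnePoint.nhds_coe_eq] at hU
    obtain ⟨m, hm⟩ := exists_tails_of_mem_nhds (mem_map.1 hU)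
    obtain ⟨K, hK, hKm⟩ := hgS m
    refine ⟨K, hK, ?_⟩
    rintro _ ⟨y, hy, rfl⟩
    exact hm _ (hKm ⟨y, hy, rfl⟩)
  · have avoid : ∀ k, ∃ K : Set ℕ, K.Finite ∧ ∀ y ∈ ρ (D \ K), g y ≠ k := fun k => by
      obtain ⟨m, hm⟩ := hC.vanish S hS k
      obtain ⟨K, hK, hKm⟩ := hgS m
      exact ⟨K, hK, fun y hy hyk => hm (hyk ▸ hKm ⟨y, hy, rfl⟩)⟩
    refine ⟨OnePoint.infty, rhoConverges_infty hmono fun x => ?_⟩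
    cases x with
    | nat n =>
      obtain ⟨K, hK, hKn⟩ := avoid n
      refine ⟨K, hK, ?_⟩
      rintro y hy ⟨_, rfl, hz⟩
      have := OnePoint.coe_injective hz
      cases this
      exact hKn y hy rfl
    | mem B =>
      obtain ⟨m, n, hmn⟩ := hC.pairwise B.2.2 hS fun h => hB ⟨B, B.2.1, h⟩
      obtain ⟨K₁, hK₁, h₁⟩ := hgS n
      obtain ⟨K₂, hK₂, h₂⟩ := exists_finite_forall_of_finite hmono (finite_Iio m)
        fun k _ => avoid k
      refine ⟨K₁ ∪ K₂, hK₁.union hK₂, ?_⟩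
      rintro y hy ⟨z, hz, hzy⟩
      have hy₁ := hmono (sdiff_subset_sdiff_right subset_union_left) hy
      have hy₂ := hmono (sdiff_subset_sdiff_right subset_union_right) hy
      cases OnePoint.coe_injective hzy
      rcases hz with hz | ⟨k, hk, hky⟩
      · cases hz
      · cases hky
        exact Set.disjoint_left.1 hmn ⟨hk, fun h => h₂ y hy₂ _ h rfl⟩ (h₁ ⟨y, hy₁, rfl⟩)

/-- The ultrafilter decides whether `f` mostly takes values in `ω`, where the hypothesis on maps to
`ℕ` applies, or is mostly constant, or neither. In the last case, countability of `Λ` lets a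
diagonal set leave `ω` and every single value of `f`, forcing convergence to infinity. -/
theorem finBWRho {Λ : Type*} [Countable Λ] {ρ : Set ℕ → Set Λ}
    (hρ : HasDiagonalUltrafilters ρ) (hmono : Monotone ρ)
    {I : Set (Set ℕ)} {C : Set (ℕ → Set ℕ)} (hC : IsOrthogonalFamily I C)
    (h : ∀ g : Λ → ℕ, ∃ D : Set ℕ, D.Infinite ∧ ((∃ n, ConvergesAlong ρ g D fun _ => {n}) ∨
        ∃ S ∈ C, ConvergesAlong ρ g D S)) :
    FinBWRho ρ (FranklinSpace (almostDisjointPart C)) := by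
  classical
  intro f
  let N : Set (FranklinSpace (almostDisjointPart C)) :=
    range fun n : ℕ => OnePoint.some (nat n : MrowkaSpace (almostDisjointPart C))
  have hN : ∀ y, ∃ n, f y ∈ N → OnePoint.some (nat n) = f y := fun y => by
    by_cases hy : f y ∈ N
    · obtain ⟨n, hn⟩ := hy
      exact ⟨n, fun _ => hn⟩
    · exact ⟨0, fun h => absurd h hy⟩
  choose g hg using hN
  obtain ⟨D, hD, hgD⟩ := h g
  obtain ⟨x, hx⟩ := exists_rhoConverges_nat hmono hC hgD
  obtain ⟨p, -, hpD, hp⟩ := hρ D hD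
  by_cases hfN : f ⁻¹' N ∈ p
  · obtain ⟨D', hD', h'⟩ := hp (fun n => ρ (D \ Iio n) ∩ f ⁻¹' N)
      fun n => inter_mem (hpD _ (finite_Iio n)) hfN
    refine ⟨D', hD', x, fun U hU => ?_⟩
    obtain ⟨K, hK, hKU⟩ := hx U hU
    obtain ⟨m, hm⟩ := hK.bddAbove
    obtain ⟨K', hK', hK'm⟩ := h' (m + 1)
    refine ⟨K', hK', ?_⟩
    rintro _ ⟨y, hy, rfl⟩
    obtain ⟨hyD, hyN⟩ := hK'm hy
    rw [← hg y hyN]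
    exact hKU ⟨y, hmono (sdiff_subset_sdiff_right fun k hk => Nat.lt_succ_of_le (hm hk)) hyD, rfl⟩
  by_cases hconst : ∃ z, f ⁻¹' {z} ∈ p
  · obtain ⟨z, hz⟩ := hconst
    obtain ⟨D', hD', h'⟩ := hp (fun _ => f ⁻¹' {z}) fun _ => hz
    refine ⟨D', hD', z, fun U hU => ?_⟩
    obtain ⟨K, hK, hKz⟩ := h' 0
    refine ⟨K, hK, ?_⟩
    rintro _ ⟨y, hy, rfl⟩
    have : f y = z := hKz hy
    rw [this]
    exact mem_of_mem_nhds hU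
  push Not at hconst
  have hne : Nonempty Λ := p.neBot.nonempty
  obtain ⟨s, hs⟩ := exists_surjective_nat Λ
  obtain ⟨D', hD', h'⟩ := hp (fun n => (f ⁻¹' N)ᶜ ∩ (f ⁻¹' {f (s n)})ᶜ) fun n =>
    inter_mem (Ultrafilter.compl_mem_iff_notMem.2 hfN)
      (Ultrafilter.compl_mem_iff_notMem.2 (hconst _))
  refine ⟨D', hD', OnePoint.infty, rhoConverges_infty hmono fun z => ?_⟩
  -- Outside `ω`, `basicNhd z` contains at most the point `z`.
  obtain ⟨K, hK, hKz⟩ : ∃ K : Set ℕ, K.Finite ∧ ∀ y ∈ ρ (D' \ K), f y ∉ N ∧ f y ≠ z := by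
    by_cases hz : ∃ y, f y = z
    · obtain ⟨y, hy⟩ := hz
      obtain ⟨n, rfl⟩ := hs y
      obtain ⟨K, hK, hKn⟩ := h' n
      exact ⟨K, hK, fun w hw => ⟨(hKn hw).1, hy ▸ (hKn hw).2⟩⟩
    · obtain ⟨K, hK, hKn⟩ := h' 0
      exact ⟨K, hK, fun w hw => ⟨(hKn hw).1, fun h => hz ⟨w, h⟩⟩⟩
  refine ⟨K, hK, ?_⟩
  rintro y hy ⟨w, hw, hwy⟩
  obtain ⟨h1, h2⟩ := hKz y hy
  cases z with
  | nat n =>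
    have hw' : w = nat n := hw
    exact h2 (by rw [← hwy, hw'])
  | mem B =>
    rcases hw with rfl | ⟨k, -, rfl⟩
    · exact h2 hwy.symm
    · exact h1 ⟨k, hwy⟩

theorem not_finBW {I : Set (Set ℕ)} (hI : IsIdealOn I) (h𝒜 : IsAlmostDisjoint 𝒜)
    (h𝒜I : 𝒜 ⊆ I) (h : ∀ A ∉ I, ∃ B ∈ 𝒜, B ⊆ A) : ¬ FinBW I (FranklinSpace 𝒜) := by
  intro hF
  obtain ⟨A, hA, x, hx⟩ := hF fun n => ((nat n : MrowkaSpace 𝒜) : FranklinSpace 𝒜)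
  obtain ⟨B, hB, hBA⟩ := h A hA
  have := t2Space h𝒜
  have : Infinite B := (h𝒜.1 B hB).to_subtype
  have h1 : Tendsto (fun n : B => ((nat (n : ℕ) : MrowkaSpace 𝒜) : FranklinSpace 𝒜)) cofinite
      (𝓝 x) := hx.comp (inclusion_injective hBA).tendsto_cofinite
  have h2 : x = ((mem ⟨B, hB⟩ : MrowkaSpace 𝒜) : FranklinSpace 𝒜) :=
    tendsto_nhds_unique h1
      ((OnePoint.continuous_coe.tendsto (mem ⟨B, hB⟩)).comp (tendsto_nat ⟨B, hB⟩))
  have h3 := hx (h2 ▸ OnePoint.isOpenEmbedding_coe.image_mem_nhds.2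
    (basicNhd_mem_nhds (mem ⟨B, hB⟩)))
  have h4 : (A \ B).Finite := by
    have h5 := (mem_cofinite.1 h3).image Subtype.val
    refine h5.subset ?_
    rintro n ⟨hnA, hnB⟩
    refine ⟨⟨n, hnA⟩, ?_, rfl⟩
    rintro ⟨w, hw, hwn⟩
    cases OnePoint.coe_injective hwn
    rcases hw with hw | ⟨k, hk, hkn⟩
    · cases hw
    · cases hkn
      exact hnB hk
  exact hI.sdiff_notMem hA (h𝒜I hB) (hI.finite_mem _ h4)

end FranklinSpace

/-! ### The space for an ideal on `ℕ`, and transport to any countably infinite set. -/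

theorem exists_niceFranklinSpace (hCH : (ℵ₁ : Cardinal.{0}) = 𝔠) {Λ : Type} [Countable Λ]
    {ρ : Set ℕ → Set Λ} (hρ : HasDiagonalUltrafilters ρ) (hmono : Monotone ρ)
    {I : Set (Set ℕ)} (hI : IsIdealOn I) (hK : ¬ KatetovLE I (idealOf ρ)) :
    ∃ 𝒜 : Set (Set ℕ), HasNiceFranklinSpace 𝒜 ∧ FinBWRho ρ (FranklinSpace 𝒜) ∧
      ¬ FinBW I (FranklinSpace 𝒜) := by
  obtain ⟨C, hC, hf, hA⟩ := exists_orthogonalFamily hCH hρ hI hK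
  have had := hC.isAlmostDisjoint
  have hhit : ∀ A ∉ I, ∃ B ∈ almostDisjointPart C, B ⊆ A := fun A hAI =>
    let ⟨B, hBA, hB, hBC⟩ := hA A hAI
    ⟨B, ⟨hB, hBC⟩, hBA⟩
  have hunc := not_countable_of_forall_exists_subset hI had.1 hhit
  refine ⟨almostDisjointPart C, ⟨fun h => hunc h.countable, had, FranklinSpace.t2Space had,
    inferInstance, FranklinSpace.separableSpace had.1, FranklinSpace.mk_eq_continuum hCH hunc⟩,
    FranklinSpace.finBWRho hρ hmono hC hf, FranklinSpace.not_finBW hI had (fun B hB => ?_) hhit⟩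
  rw [← tails_zero B]
  exact hC.mem _ hB.2

theorem exists_niceFranklinSpace_of_countable (hCH : (ℵ₁ : Cardinal.{0}) = 𝔠) {Λ : Type}
    [Countable Λ] {ρ : Set ℕ → Set Λ} (hρ : HasDiagonalUltrafilters ρ) (hmono : Monotone ρ)
    {Γ : Type*} [Countable Γ] [Infinite Γ] {I : Set (Set Γ)} (hI : IsIdealOn I)
    (hK : ¬ KatetovLE I (idealOf ρ)) :
    ∃ 𝒜 : Set (Set ℕ), HasNiceFranklinSpace 𝒜 ∧ FinBWRho ρ (FranklinSpace 𝒜) ∧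
      ¬ FinBW I (FranklinSpace 𝒜) := by
  obtain ⟨e⟩ : Nonempty (Γ ≃ ℕ) := nonempty_equiv_of_countable
  let J : Set (Set ℕ) := {A | e ⁻¹' A ∈ I}
  have hJ : IsIdealOn J :=
    { subset_mem := fun A B hAB hB => hI.subset_mem _ _ (preimage_mono hAB) hB
      union_mem := fun A B hA hB => hI.union_mem _ _ hA hB
      univ_notMem := hI.univ_notMem
      finite_mem := fun A hA => hI.finite_mem _ (hA.preimage e.injective.injOn) }
  have hKJ : ¬ KatetovLE J (idealOf ρ) := by
    rintro ⟨φ, hφ⟩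
    refine hK ⟨e.symm ∘ φ, fun A hA hmem => hφ A hA ?_⟩
    change e ⁻¹' (φ '' A) ∈ I
    rwa [← Equiv.image_symm_eq_preimage, ← image_comp]
  obtain ⟨𝒜, h1, h2, h3⟩ := exists_niceFranklinSpace hCH hρ hmono hJ hKJ
  refine ⟨𝒜, h1, h2, fun hF => h3 fun f => ?_⟩
  obtain ⟨A, hA, x, hx⟩ := hF (f ∘ e)
  refine ⟨e '' A, fun h => hA ?_, x, ?_⟩
  · change e ⁻¹' (e '' A) ∈ I at h
    rwa [preimage_image_eq _ e.injective] at h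
  · have h4 := hx.comp (e.image A).symm.injective.tendsto_cofinite
    refine h4.congr fun a => ?_
    obtain ⟨a', rfl⟩ := (e.image A).surjective a
    simp

/-! ### The summable ideal is not Katetov below the three ideals. -/

theorem mem_summableIdeal_iff {A : Set ℕ} :
    A ∈ summableIdeal ↔ Summable (A.indicator fun n : ℕ => 1 / ((n : ℝ) + 1)) :=
  summable_subtype_iff_indicator (f := fun n : ℕ => 1 / ((n : ℝ) + 1))

theorem isIdealOn_summableIdeal : IsIdealOn summableIdeal where
  subset_mem A B hAB hB := by
    rw [mem_summableIdeal_iff] at hB ⊢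
    refine hB.of_nonneg_of_le (fun n => indicator_nonneg (fun _ _ => by positivity) n) fun n => ?_
    exact indicator_le_indicator_of_subset hAB (fun _ => by positivity) n
  union_mem A B hA hB := by
    rw [mem_summableIdeal_iff] at hA hB ⊢
    refine (hA.add hB).of_nonneg_of_le
      (fun n => indicator_nonneg (fun _ _ => by positivity) n) fun n => ?_
    have hpos : (0 : ℝ) ≤ 1 / ((n : ℝ) + 1) := by positivity
    by_cases h1 : n ∈ A <;> by_cases h2 : n ∈ B <;> (simp [h1, h2]; try positivity)
  univ_notMem h := by
    rw [mem_summableIdeal_iff, indicator_univ] at h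
    have h2 := (summable_nat_add_iff (f := fun n : ℕ => 1 / (n : ℝ)) 1).1 (by simpa using h)
    exact Real.not_summable_one_div_natCast h2
  finite_mem A hA := by
    have := hA.to_subtype
    exact Summable.of_finite

/-- Each tag `i` names at most one value, so distinct elements of `V` get distinct codes, and the
sum is dominated by `∑ 2⁻ᵏ`. -/
theorem mem_summableIdeal_of_two_pow_encode_le {ι : Type*} [Encodable ι] (P : ι → ℕ → Prop)
    (hP : ∀ i v w, P i v → P i w → v = w) {V : Set ℕ}
    (hV : ∀ v ∈ V, ∃ i, P i v ∧ 2 ^ Encodable.encode i ≤ v) : V ∈ summableIdeal := by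
  choose i hi hiv using fun v : V => hV v v.2
  have hinj : Function.Injective fun v : V => Encodable.encode (i v) := by
    intro v w hvw
    have h1 : i v = i w := Encodable.encode_injective hvw
    exact Subtype.ext (hP _ _ _ (hi v) (h1 ▸ hi w))
  refine (summable_geometric_two.comp_injective hinj).of_nonneg_of_le
    (fun v => by positivity) fun v => ?_
  have h2 : (2 : ℝ) ^ Encodable.encode (i v) ≤ ((v : ℕ) : ℝ) + 1 := by
    have : ((2 ^ Encodable.encode (i v) : ℕ) : ℝ) ≤ ((v : ℕ) : ℝ) := by exact_mod_cast hiv v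
    push_cast at this
    linarith
  simp only [Function.comp_apply, one_div, inv_pow]
  exact inv_anti₀ (by positivity) h2

theorem eventually_forall_le_of_frequently_ne {α : Type*} {U : Ultrafilter α}
    {L : α → ℕ → Prop} (h : ∀ a, ¬ ∀ᶠ x in U, L x a) (N : ℕ) :
    ∀ᶠ x in U, ∀ a, L x a → N ≤ a := by
  have h1 : ∀ᶠ x in U, ∀ a ∈ Finset.range N, ¬ L x a :=
    (Filter.eventually_all_finset _).2 fun a _ => Ultrafilter.eventually_not.2 (h a)
  filter_upwards [h1] with x hx a ha
  by_contra hN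
  exact hx a (Finset.mem_range.2 (not_le.1 hN)) ha

theorem eq_of_eventually_eq {α β : Type*} {U : Filter α} [U.NeBot] {f : α → β} {a b : β}
    (ha : ∀ᶠ x in U, f x = a) (hb : ∀ᶠ x in U, f x = b) : a = b := by
  obtain ⟨x, hx, hx'⟩ := (ha.and hb).exists
  exact hx.symm.trans hx'

theorem not_katetovLE_idealOf {Λ : Type*} {ρ : Set ℕ → Set Λ} {I : Set (Set ℕ)}
    (h : ∀ φ : Λ → ℕ, ∃ D : Set ℕ, D.Infinite ∧ φ '' ρ D ∈ I) : ¬ KatetovLE I (idealOf ρ) := by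
  rintro ⟨φ, hφ⟩
  obtain ⟨D, hD, hφD⟩ := h φ
  exact hφ (ρ D) (fun hmem => hmem D hD subset_rfl) hφD

theorem exists_image_mem_of_preimage_singleton {Λ : Type*} {ρ : Set ℕ → Set Λ}
    {I : Set (Set ℕ)} (hI : IsIdealOn I) {φ : Λ → ℕ} {a : ℕ}
    (h : ∃ D : Set ℕ, D.Infinite ∧ ∃ K : Set ℕ, K.Finite ∧ ρ (D \ K) ⊆ φ ⁻¹' {a}) :
    ∃ D : Set ℕ, D.Infinite ∧ φ '' ρ D ∈ I := by
  obtain ⟨D, hD, K, hK, hDA⟩ := h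
  exact ⟨D \ K, hD.sdiff hK, hI.finite_mem _
    ((finite_singleton a).subset (image_subset_iff.2 hDA))⟩

/-- Unless `φ` is constant on a large set, `d` is chosen so that `φ {d i, d j}` is either the limit
value of `φ {d i, ·}`, tagged `inl i`, or a value tagged `inr (i, j)`. No limit value is shared by
almost all points, so both kinds can be pushed above the power of two of their tag. -/
theorem exists_image_pairsOf_mem_summableIdeal (φ : NatPair → ℕ) :
    ∃ D : Set ℕ, D.Infinite ∧ φ '' pairsOf D ∈ summableIdeal := by
  obtain ⟨v, hv, -⟩ := exists_ultrafilter_mem_le_cofinite infinite_univ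
  by_cases hconst : ∃ a, φ ⁻¹' {a} ∈ pairUltrafilter v
  · obtain ⟨a, ha⟩ := hconst
    obtain ⟨D, hD, h⟩ := pairUltrafilter_diagonal hv (fun _ => φ ⁻¹' {a}) fun _ => ha
    exact exists_image_mem_of_preimage_singleton isIdealOn_summableIdeal ⟨D, hD, h 0⟩
  push Not at hconst
  let L : ℕ → ℕ → Prop := fun x a => ∀ᶠ e in v, φ (mkNatPair x e) = a
  have hL : ∀ a, ¬ ∀ᶠ x in v, L x a := hconst
  obtain ⟨d, hd, hR⟩ := exists_strictMono_of_eventually v hv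
    (fun n h x => (∀ i ∈ Iio n, (∀ a, L (h i) a → φ (mkNatPair (h i) x) = a) ∧
      ((∀ a, ¬ L (h i) a) → 2 ^ Encodable.encode (Sum.inr (i, n) : ℕ ⊕ ℕ × ℕ) ≤
        φ (mkNatPair (h i) x))) ∧
      ∀ a, L x a → 2 ^ Encodable.encode (Sum.inl n : ℕ ⊕ ℕ × ℕ) ≤ a) (by
    intro n h
    refine Filter.Eventually.and ?_ (eventually_forall_le_of_frequently_ne hL _)
    refine (Filter.eventually_all_finite (Set.finite_Iio n)).2 fun i _ => ?_
    by_cases hi : ∃ a, L (h i) a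
    · obtain ⟨a, ha⟩ := hi
      filter_upwards [ha] with x hx
      exact ⟨fun b hb => hx.trans (eq_of_eventually_eq ha hb), fun hno => absurd ha (hno a)⟩
    · push Not at hi
      filter_upwards [eventually_forall_le_of_frequently_ne
        (L := fun x a => φ (mkNatPair (h i) x) = a) hi _] with x hx
      exact ⟨fun b hb => absurd hb (hi b), fun _ => hx _ rfl⟩)
  refine ⟨range d, infinite_range_of_injective hd.injective,
    mem_summableIdeal_of_two_pow_encode_le (ι := ℕ ⊕ ℕ × ℕ)
      (fun t a => Sum.elim (fun n => L (d n) a) (fun q => φ (mkNatPair (d q.1) (d q.2)) = a) t)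
      ?_ ?_⟩
  · rintro (n | q) a b ha hb
    · exact eq_of_eventually_eq ha hb
    · exact (show _ = a from ha).symm.trans hb
  · suffices pairsOf (range d \ d '' Iio 0) ⊆ φ ⁻¹' {a | ∃ t : ℕ ⊕ ℕ × ℕ,
        Sum.elim (fun n => L (d n) a) (fun q => φ (mkNatPair (d q.1) (d q.2)) = a) t ∧
          2 ^ Encodable.encode t ≤ a} by
      rintro _ ⟨s, hs, rfl⟩
      exact this (by simpa using hs)
    refine pairsOf_range_sdiff_subset hd fun i j _ hij => ?_
    obtain ⟨h, hh, hj, -⟩ := hR j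
    obtain ⟨-, -, -, hi⟩ := hR i
    have hj' := hj i hij
    rw [hh i hij] at hj'
    by_cases hex : ∃ a, L (d i) a
    · obtain ⟨a, ha⟩ := hex
      have := hj'.1 a ha
      exact ⟨Sum.inl i, by simpa [this] using ha, by rw [this]; exact hi a ha⟩
    · exact ⟨Sum.inr (i, j), rfl, hj'.2 fun a ha => hex ⟨a, ha⟩⟩

/-- Here `L x a` says that `a` is the limit value at the partial sum `x`. By idempotence, adding a
further term can preserve a limit value. Without one, both the new value of `φ` and any new limit
value can be made large. -/
theorem exists_image_finiteSums_mem_summableIdeal (φ : ℕ → ℕ) :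
    ∃ D : Set ℕ, D.Infinite ∧ φ '' finiteSums D ∈ summableIdeal := by
  obtain ⟨U, hadd, hUE⟩ := exists_additive_ultrafilter infinite_univ
  have hU := le_cofinite_of_finiteSums_mem hUE
  by_cases hconst : ∃ a, φ ⁻¹' {a} ∈ U
  · obtain ⟨a, ha⟩ := hconst
    obtain ⟨D, hD, h⟩ := additive_ultrafilter_diagonal hadd hU (fun _ => φ ⁻¹' {a}) fun _ => ha
    exact exists_image_mem_of_preimage_singleton isIdealOn_summableIdeal ⟨D, hD, h 0⟩
  push Not at hconst
  let L : ℕ → ℕ → Prop := fun x a => ∀ᶠ e in U, φ (x + e) = a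
  have hLadd : ∀ x a, L x a ↔ ∀ᶠ d in U, L (x + d) a := fun x a => by
    simpa only [← add_assoc] using hadd fun e => φ (x + e) = a
  have hL0 : ∀ a, ¬ L 0 a := fun a ha => hconst a (by simp only [L, zero_add] at ha; exact ha)
  obtain ⟨d, hd, hR⟩ := exists_strictMono_of_eventually U hU
    (fun n h x => ∀ β ∈ (Finset.range n).powerset,
      (∀ a, L (∑ i ∈ β, h i) a → φ (∑ i ∈ β, h i + x) = a ∧ L (∑ i ∈ β, h i + x) a) ∧
      ((∀ a, ¬ L (∑ i ∈ β, h i) a) →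
        2 ^ Encodable.encode (Sum.inl (insert n β) : Finset ℕ ⊕ Finset ℕ) ≤
          φ (∑ i ∈ β, h i + x) ∧
        ∀ a, L (∑ i ∈ β, h i + x) a →
          2 ^ Encodable.encode (Sum.inr (insert n β) : Finset ℕ ⊕ Finset ℕ) ≤ a)) (by
    intro n h
    refine (Filter.eventually_all_finset _).2 fun β _ => ?_
    by_cases hi : ∃ a, L (∑ i ∈ β, h i) a
    · obtain ⟨a, ha⟩ := hi
      filter_upwards [ha, (hLadd _ _).1 ha] with x hx hx'
      refine ⟨fun b hb => ?_, fun hno => absurd ha (hno a)⟩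
      rw [← eq_of_eventually_eq ha hb]
      exact ⟨hx, hx'⟩
    · push Not at hi
      filter_upwards [eventually_forall_le_of_frequently_ne
        (L := fun x a => φ (∑ i ∈ β, h i + x) = a) hi _, eventually_forall_le_of_frequently_ne
        (L := fun x a => L (∑ i ∈ β, h i + x) a) (fun a ha => hi a ((hLadd _ _).2 ha)) _]
        with x hx hx'
      exact ⟨fun b hb => absurd hb (hi b), fun _ => ⟨hx _ rfl, hx'⟩⟩)
  -- `inl α` tags the value of `φ` at the sum over `α`, `inr α` the limit value there.
  let P : Finset ℕ ⊕ Finset ℕ → ℕ → Prop := fun t a =>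
    Sum.elim (fun α : Finset ℕ => φ (∑ i ∈ α, d i) = a) (fun α => L (∑ i ∈ α, d i) a) t
  have key : ∀ α : Finset ℕ,
      (∀ a, L (∑ i ∈ α, d i) a → ∃ t, P t a ∧ 2 ^ Encodable.encode t ≤ a) ∧
      (α.Nonempty → ∃ t, P t (φ (∑ i ∈ α, d i)) ∧
        2 ^ Encodable.encode t ≤ φ (∑ i ∈ α, d i)) := by
    intro α
    induction α using Finset.induction_on_max with
    | empty => exact ⟨fun a ha => absurd ha (hL0 a), by simp⟩
    | insert m β hβ ih =>
      obtain ⟨h, hh, hRm⟩ := hR m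
      have hsum : ∑ i ∈ β, h i = ∑ i ∈ β, d i := Finset.sum_congr rfl fun i hi => hh i (hβ i hi)
      have hm := hRm β (Finset.mem_powerset.2 fun i hi => Finset.mem_range.2 (hβ i hi))
      have hins : ∑ i ∈ insert m β, d i = ∑ i ∈ β, d i + d m := by
        rw [Finset.sum_insert fun hmem => (hβ m hmem).false, add_comm]
      rw [hsum, ← hins] at hm
      -- A limit value at `β` passes to `insert m β` together with its old tag; otherwise `insert m
      -- β` supplies a new tag.
      by_cases hex : ∃ a, L (∑ i ∈ β, d i) a
      · obtain ⟨a, ha⟩ := hex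
        obtain ⟨h1, h2⟩ := hm.1 a ha
        refine ⟨fun b hb => ?_, fun _ => ?_⟩
        · rw [← eq_of_eventually_eq h2 hb]
          exact ih.1 a ha
        · rw [h1]
          exact ih.1 a ha
      · push Not at hex
        obtain ⟨h1, h2⟩ := hm.2 hex
        exact ⟨fun b hb => ⟨Sum.inr (insert m β), hb, h2 b hb⟩,
          fun _ => ⟨Sum.inl (insert m β), rfl, h1⟩⟩
  refine ⟨range d, infinite_range_of_injective hd.injective,
    mem_summableIdeal_of_two_pow_encode_le P ?_ ?_⟩
  · rintro (α | α) a b ha hb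
    · exact (show _ = a from ha).symm.trans hb
    · exact eq_of_eventually_eq ha hb
  · rintro _ ⟨x, hx, rfl⟩
    obtain ⟨β, hβ, -, rfl⟩ := exists_indices_of_mem_finiteSums hd (n := 0) (by simpa using hx)
    exact (key β).2 hβ

theorem exists_image_posDifferences_mem_summableIdeal (φ : ℕ → ℕ) :
    ∃ D : Set ℕ, D.Infinite ∧ φ '' posDifferences D ∈ summableIdeal := by
  obtain ⟨D, hD, h⟩ := exists_image_pairsOf_mem_summableIdeal (φ ∘ pairDifference)
  exact ⟨D, hD, by rwa [posDifferences_eq_image, ← image_comp]⟩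

theorem mainTheorem5 (hCH : (ℵ₁ : Cardinal.{0}) = 𝔠) :
    (∀ (Λ : Type*) [Countable Λ] [Infinite Λ] (I : Set (Set Λ)), IsIdealOn I →
      (¬ KatetovLE I hindmanIdeal → ∃ 𝒜 : Set (Set ℕ), HasNiceFranklinSpace 𝒜 ∧
        IsHindmanSpace (FranklinSpace 𝒜) ∧ ¬ FinBW I (FranklinSpace 𝒜)) ∧
      (¬ KatetovLE I ramseyIdeal → ∃ 𝒜 : Set (Set ℕ), HasNiceFranklinSpace 𝒜 ∧
        IsRamseySpace (FranklinSpace 𝒜) ∧ ¬ FinBW I (FranklinSpace 𝒜)) ∧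
      (¬ KatetovLE I differenceIdeal → ∃ 𝒜 : Set (Set ℕ), HasNiceFranklinSpace 𝒜 ∧
        IsDifferentiallyCompact (FranklinSpace 𝒜) ∧ ¬ FinBW I (FranklinSpace 𝒜))) ∧
    (∃ 𝒜 : Set (Set ℕ), HasNiceFranklinSpace 𝒜 ∧
      IsHindmanSpace (FranklinSpace 𝒜) ∧ ¬ FinBW summableIdeal (FranklinSpace 𝒜)) ∧
    (∃ 𝒜 : Set (Set ℕ), HasNiceFranklinSpace 𝒜 ∧
      IsRamseySpace (FranklinSpace 𝒜) ∧ ¬ FinBW summableIdeal (FranklinSpace 𝒜)) ∧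
    (∃ 𝒜 : Set (Set ℕ), HasNiceFranklinSpace 𝒜 ∧
      IsDifferentiallyCompact (FranklinSpace 𝒜) ∧
        ¬ FinBW summableIdeal (FranklinSpace 𝒜)) := by
  have hpair : Countable NatPair := Subtype.countable
  have hs := isIdealOn_summableIdeal
  refine ⟨fun Λ _ _ I hI => ⟨fun hK => ?_, fun hK => ?_, fun hK => ?_⟩, ?_, ?_, ?_⟩
  · exact exists_niceFranklinSpace_of_countable hCH hasDiagonalUltrafilters_finiteSums
      finiteSums_mono hI hK
  · exact exists_niceFranklinSpace_of_countable hCH hasDiagonalUltrafilters_pairsOf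
      pairsOf_mono hI hK
  · exact exists_niceFranklinSpace_of_countable hCH hasDiagonalUltrafilters_posDifferences
      posDifferences_mono hI hK
  · exact exists_niceFranklinSpace hCH hasDiagonalUltrafilters_finiteSums finiteSums_mono hs
      (not_katetovLE_idealOf exists_image_finiteSums_mem_summableIdeal)
  · exact exists_niceFranklinSpace hCH hasDiagonalUltrafilters_pairsOf pairsOf_mono hs
      (not_katetovLE_idealOf exists_image_pairsOf_mem_summableIdeal)
  · exact exists_niceFranklinSpace hCH hasDiagonalUltrafilters_posDifferences
      posDifferences_mono hs (not_katetovLE_idealOf exists_image_posDifferences_mem_summableIdeal)
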